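/- Let $n\ge 1$ and write $[n]=\{1,\dots,n\}$. Let $\mathcal H_n$ be the arrangement in $\mathbb R^n$ of the hyperplanes $x_i=0$ ($1\le i\le n$) and $x_i+x_j=0$ ($1\le i<j\le n$), and let $P=\{x\in\mathbb R^n : l_1x_1+\dots+l_nx_n=1\}$, where $l_1\gg l_2\gg\dots\gg l_n>0$, meaning that every $l_i$ is positive and $l_i>l_{i+1}+\dots+l_n$ for every $i$. Then the following seven sets are finite and in bijection with each other: 1. the set of bounded regions of the arrangement $\{H\cap P: H\in\mathcal H_n\}$ in the affine space $P$, a region being a connected component of $P\setminus\bigcup_{H\in\mathcal H_n}H$; 2. the set of ordered partitions $(A_1,\dots,A_k)$ of $[n]$ (sequences of disjoint non-empty sets with union $[n]$) such that each left-to-right minimum $\min(A_1\cup\dots\cup A_i)$, $1\le i\le k$, lies in a block $A_j$ with $j$ odd; 3. the set of signed permutations of $[n]$, i.e. pairs of a permutation $(a_1,\dots,a_n)$ of $[n]$ and a map $\sigma:[n]\to\{\pm1\}$, such that $a_i>a_{i+1}$ whenever $\sigma(a_i)=\sigma(a_{i+1})$, and $\sigma(\min(a_1,\dots,a_i))=+1$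 for all $1\le i\le n$; 4. the set of build-tree codes of length $n$, i.e. sequences $c_1\cdots c_n$ of pairs $c_i=(a_i,\sigma_i)$ with $0\le a_i\le i-1$ an integer, $\sigma_i\in\{\pm1\}$ and $(a_i,\sigma_i)\ne(0,-1)$, such that for each $i$ with $c_i=(v,-1)$ there is a $j>i$ with $c_j=(v,+1)$; 5. the set of build-tree codes of length $n$ such that for each $i$ with $c_i=(v,-1)$ there is a $j<i$ with $c_j=(v,+1)$; 6. the set of Klazar trees with $n+1$ vertices, i.e. rooted plane trees whose vertices are labeled bijectively by $0,1,\dots,n$ so that each child has a larger label than its parent, and in which every vertex $v$ that has a right associate $u$ is not a leaf and has a child whose label is smaller than that of $u$. Here the right associate of $v$ is the vertex of smallest label (if there is any) among the siblings $u$ to the right of $v$ whose label is larger than that of $v$ and smaller than those of all siblings strictly between $v$ and $u$; 7. the set of drawings of rooted plane trees with $n+1$ vertices, i.e. sequences $T_0,T_1,\dots,T_n$ of (unlabeled) rooted plane trees such that $T_0$ is the one-vertex tree and each $T_i$ ($0\le i<n$) can be obtained from $T_{i+1}$ by removing a non-root leaf together with its pendant edge. Their common cardinality $b_n$ depends only on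 $n$, and with $b_0=1$ the following identity of formal power series holds, the square root being the one with constant term $1$: $$\sum_{n=0}^{\infty} b_n\frac{x^n}{n!}=\sqrt{\frac{e^x}{2-e^x}}.$$ -/

import Mathlib

/-! Throughout, the ordered set `[n] = {1, …, n}` is modelled by `Fin n`; the element `i : Fin n`
stands for the number `i + 1`. -/

namespace PlaneTreeDrawings

/-! ### Bounded regions of the sliced hyperplane arrangement -/

/-- The arrangement in `ℝⁿ` of the hyperplanes `x_i = 0` and `x_i + x_j = 0` for `i < j`. -/
def arrangement (n : ℕ) : Set (Set (Fin n → ℝ)) :=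
  {H | (∃ i, H = {x | x i = 0}) ∨ (∃ i j, i < j ∧ H = {x | x i + x j = 0})}

/-- The affine hyperplane `l_1 x_1 + ⋯ + l_n x_n = 1`. -/
def slice {n : ℕ} (l : Fin n → ℝ) : Set (Fin n → ℝ) :=
  {x | ∑ i, l i * x i = 1}

/-- `l_1 ≫ l_2 ≫ ⋯ ≫ l_n > 0`: all `l_i` are positive and each of them exceeds the sum of
all later ones. -/
def StronglyDecreasing {n : ℕ} (l : Fin n → ℝ) : Prop :=
  ∀ i, 0 < l i ∧ ∑ j ∈ Finset.Ioi i, l j < l i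

/-- The regions of the arrangement induced on `P` by `𝒜`: the connected components of the
complement in `P` of the union of the sets `H ∩ P`, `H ∈ 𝒜`. -/
def regions {n : ℕ} (𝒜 : Set (Set (Fin n → ℝ))) (P : Set (Fin n → ℝ)) :
    Set (Set (Fin n → ℝ)) :=
  {R | ∃ x ∈ P \ ⋃ H ∈ 𝒜, H ∩ P, R = connectedComponentIn (P \ ⋃ H ∈ 𝒜, H ∩ P) x}

/-- The bounded regions of the arrangement sliced by `l_1 x_1 + ⋯ + l_n x_n = 1`. -/
def boundedRegions {n : ℕ} (l : Fin n → ℝ) : Set (Set (Fin n → ℝ)) :=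
  {R | R ∈ regions (arrangement n) (slice l) ∧ Bornology.IsBounded R}

/-! ### Ordered partitions -/

/-- An ordered partition of `[n]`: a sequence of disjoint non-empty blocks with union `[n]`. -/
@[ext]
structure OrderedPartition (n : ℕ) where
  blocks : List (Finset (Fin n))
  nonempty : ∀ B ∈ blocks, B.Nonempty
  disjoint : blocks.Pairwise Disjoint
  cover : ∀ x, ∃ B ∈ blocks, x ∈ B

/-- `m` is a left-to-right minimum: `m = min (A_1 ∪ ⋯ ∪ A_i)` for some `1 ≤ i ≤ k`. -/
def OrderedPartition.IsLeftToRightMin {n : ℕ} (A : OrderedPartition n) (m : Fin n) : Prop :=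
  ∃ i, 1 ≤ i ∧ i ≤ A.blocks.length ∧ IsLeast {x | ∃ B ∈ A.blocks.take i, x ∈ B} m

/-- `m` lies in `A_j` for some odd `j`; `A_j` is the entry of the list with 0-based index `j - 1`,
so that the index in the list is even. -/
def OrderedPartition.AtOddLocation {n : ℕ} (A : OrderedPartition n) (m : Fin n) : Prop :=
  ∃ (j : ℕ) (hj : j < A.blocks.length), Even j ∧ m ∈ A.blocks[j]

/-- The ordered partitions all of whose left-to-right minima occur at odd locations. -/
def oddMinPartitions (n : ℕ) : Set (OrderedPartition n) :=
  {A | ∀ m, A.IsLeftToRightMin m → A.AtOddLocation m}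

/-! ### Signed permutations -/

/-- A signed permutation `((a_1, …, a_n), σ)`; `a i` is the entry at position `i`, and `σ v` is the
sign of the value `v`. -/
@[ext]
structure SignedPermutation (n : ℕ) where
  a : Equiv.Perm (Fin n)
  σ : Fin n → ℤˣ

/-- Adjacent entries of equal sign are decreasing. -/
def SignedPermutation.HasDecreasingBlocks {n : ℕ} (p : SignedPermutation n) : Prop :=
  ∀ i j : Fin n, (j : ℕ) = i + 1 → p.σ (p.a i) = p.σ (p.a j) → p.a j < p.a i

/-- `m = min (a_1, …, a_i)` for some `i`. -/
def SignedPermutation.IsLeftToRightMin {n : ℕ} (p : SignedPermutation n) (m : Fin n) : Prop :=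
  ∃ i, IsLeast (p.a '' Set.Iic i) m

/-- The signed permutations with decreasing blocks all of whose left-to-right minima are
positive. -/
def positiveMinSignedPerms (n : ℕ) : Set (SignedPermutation n) :=
  {p | p.HasDecreasingBlocks ∧ ∀ m, p.IsLeftToRightMin m → p.σ m = 1}

/-! ### Build-tree codes -/

/-- A build-tree code `c_1 ⋯ c_n`, `c_i = (a_i, σ_i)` with `0 ≤ a_i ≤ i - 1` and
`(a_i, σ_i) ≠ (0, -1)`. Positions are 0-based, so that the bound on `a i` is `i`. -/
@[ext]
structure BuildTreeCode (n : ℕ) where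
  a : Fin n → ℕ
  σ : Fin n → ℤˣ
  a_le : ∀ i, a i ≤ i
  ne_zero_neg : ∀ i, (a i, σ i) ≠ (0, -1)

/-- The build-tree codes with a `v⁺` after each `v⁻`. -/
def plusAfterCodes (n : ℕ) : Set (BuildTreeCode n) :=
  {c | ∀ i, c.σ i = -1 → ∃ j, i < j ∧ c.a j = c.a i ∧ c.σ j = 1}

/-- The build-tree codes with a `v⁺` before each `v⁻`. -/
def plusBeforeCodes (n : ℕ) : Set (BuildTreeCode n) :=
  {c | ∀ i, c.σ i = -1 → ∃ j, j < i ∧ c.a j = c.a i ∧ c.σ j = 1}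

/-! ### Rooted plane trees -/

/-- Rooted plane trees whose vertices carry labels in `α`; the children of each vertex are listed
from left to right. Unlabeled rooted plane trees are obtained for `α = Unit`. -/
inductive PlaneTree (α : Type) : Type
  | node (label : α) (children : List (PlaneTree α)) : PlaneTree α

namespace PlaneTree

variable {α : Type}

/-- The label of the root. -/
def label : PlaneTree α → α
  | node a _ => a

/-- The subtrees at the children of the root, from left to right. -/
def children : PlaneTree α → List (PlaneTree α)
  | node _ cs => cs

/-- The labels of all vertices (one entry for each vertex), in preorder. -/
def labels : PlaneTree α → List α
  | node a cs => a :: cs.flatMap labels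

/-- `IsSubtree s t`: `s` is the subtree of all descendants of some vertex of `t`. -/
inductive IsSubtree : PlaneTree α → PlaneTree α → Prop
  | refl (t : PlaneTree α) : IsSubtree t t
  | child {s c t : PlaneTree α} : c ∈ t.children → IsSubtree s c → IsSubtree s t

/-- `RemoveLeaf t t'`: `t'` is obtained from `t` by removing a (non-root) leaf together with its
pendant edge. -/
inductive RemoveLeaf : PlaneTree α → PlaneTree α → Prop
  | here (a b : α) (L R : List (PlaneTree α)) :
      RemoveLeaf (node a (L ++ node b [] :: R)) (node a (L ++ R))
  | there (a : α) (L R : List (PlaneTree α)) (t t' : PlaneTree α) :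
      RemoveLeaf t t' → RemoveLeaf (node a (L ++ t :: R)) (node a (L ++ t' :: R))

/-- `T` is an increasingly labeled tree with `n + 1` vertices: the labels are `0, 1, …, n`, each
used exactly once, and every child has a larger label than its parent. -/
def IsIncreasinglyLabeled (n : ℕ) (T : PlaneTree ℕ) : Prop :=
  T.labels.Perm (List.range (n + 1)) ∧
    ∀ s, IsSubtree s T → ∀ c ∈ s.children, s.label < c.label

/-- Among siblings `cs` (from left to right), the sibling with index `j` is to the right of the one
with index `i`, has a larger label than it, and has a smaller label than all siblings between. -/
def IsRightCandidate (cs : List (PlaneTree ℕ)) (i j : Fin cs.length) : Prop :=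
  i < j ∧ cs[i].label < cs[j].label ∧ ∀ k, i < k → k < j → cs[j].label < cs[k].label

/-- The sibling with index `j` is the right associate of the one with index `i`: the candidate of
smallest label. -/
def IsRightAssociate (cs : List (PlaneTree ℕ)) (i j : Fin cs.length) : Prop :=
  IsRightCandidate cs i j ∧ ∀ j', IsRightCandidate cs i j' → cs[j].label ≤ cs[j'].label

/-- Klazar trees with `n + 1` vertices: increasingly labeled trees in which every vertex `v` with a
right associate `u` is not a leaf, and the label of `u` is larger than the minimum of the labels of
the children of `v`. -/
def IsKlazar (n : ℕ) (T : PlaneTree ℕ) : Prop :=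
  T.IsIncreasinglyLabeled n ∧
    ∀ s, IsSubtree s T → ∀ i j : Fin s.children.length, IsRightAssociate s.children i j →
      s.children[i].children ≠ [] ∧
        ∀ m, IsLeast {x | ∃ d ∈ s.children[i].children, d.label = x} m →
          m < s.children[j].label

end PlaneTree

/-- The set of Klazar trees with `n + 1` vertices. -/
def klazarTrees (n : ℕ) : Set (PlaneTree ℕ) :=
  {T | T.IsKlazar n}

/-- The drawings of rooted plane trees with `n + 1` vertices: sequences `T_0, …, T_n` of rooted
plane trees, starting at the one-vertex tree, in which each `T_i` is obtained from `T_{i+1}` by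
removing a leaf. -/
def drawings (n : ℕ) : Set (Fin (n + 1) → PlaneTree Unit) :=
  {T | T 0 = .node () [] ∧ ∀ i : Fin n, PlaneTree.RemoveLeaf (T i.succ) (T i.castSucc)}

/-! ### Generating functions -/

/-- The exponential generating function `∑ b_n xⁿ / n!`, as a formal power series. -/
noncomputable def egf (b : ℕ → ℕ) : PowerSeries ℚ :=
  PowerSeries.mk fun n => (b n : ℚ) / (n.factorial : ℚ)

/-- `F = √G` for formal power series `G` with constant term `1`: the square root is the one with
constant term `1`. -/
def IsPowerSeriesSqrt (F G : PowerSeries ℚ) : Prop :=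
  F ^ 2 = G ∧ PowerSeries.constantCoeff F = 1

end PlaneTreeDrawings

namespace PlaneTreeDrawings

/-! ### The counting sequence -/

/-! All seven sets have `pathCount n 0 1` elements. They fall into two groups, and an identity of
exponential generating functions joins the groups.

Codes and trees are counted by a generating tree (`encard_eq_pathCount`): each object of size n+1
has a unique parent of size n, and an object with statistics (a, b) has a children with (a, b+2) and
b children with (a+1, b), starting from (0, 1). For codes with a plus before each minus, a is the
number of v in 1, …, n without v⁺ and b = 2n+1-2a; exchanging first and last signs gives the codes
with a plus after each minus. For drawings and Klazar trees, a is the number of leaves of the forest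
below the root and b the number of places where a new leaf raises that number. Both kinds of tree
grow by the same operation `insertions`: a leaf is never put directly to the right of a leaf. In a
drawing this avoids obtaining the same tree twice; in a Klazar tree the left neighbor of the new
largest label must have a child.

Regions, ordered partitions and signed permutations are encoded by block-index functions, the
members of `evenMin`. Signs together with a ranking, by position or by decreasing absolute value,
determine such a function uniquely: the index is the length of the longest sign-alternating chain
leading up to an element (`exists_compatible`, `Compatible.unique`). For regions, boundedness
corresponds to the parity condition on minima. An odd minimum yields an escaping ray. If all minima
are even, the smallest index in each level set of |x| has a positive entry, so its coefficient
dominates and a layer-cake sum bounds |x| on the slice.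

Let P and E be the exponential generating functions of all packed functions and of `evenMin`.
Splitting at the least element gives E' = PE, and removing the first block gives P = 1/(2 - eˣ).
Hence E² = eˣP, the required square root. Moreover P' = E²P, so (PᵃEᵇ)' = a PᵃEᵇ⁺² + b Pᵃ⁺¹Eᵇ. This
is the rule of the generating tree, whence the n-th derivative of E at 0 is `pathCount n 0 1`
(`card_evenMin`). -/

/-- The number of paths of length `n` in the generating tree in which a vertex with statistics
`(a, b)` has `a` children with statistics `(a, b + 2)` and `b` children with `(a + 1, b)`. -/
def pathCount : ℕ → ℕ → ℕ → ℕ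
  | 0, _, _ => 1
  | n + 1, a, b => a * pathCount n a (b + 2) + b * pathCount n (a + 1) b

/-! ### Packed functions -/

/-- A function to `ℕ` whose range is an initial segment; it encodes an ordered partition, the
value being the index of the block. -/
def IsPacked {ι : Type*} (f : ι → ℕ) : Prop := ∀ i, ∀ k < f i, ∃ j, f j = k

/-- The packed functions on `ι`. -/
def packed (ι : Type*) : Set (ι → ℕ) := {f | IsPacked f}

/-- The packed functions that take even values at all left-to-right minima. -/
def evenMin (ι : Type*) [LinearOrder ι] : Set (ι → ℕ) :=
  {f | IsPacked f ∧ ∀ m, (∀ j < m, f m < f j) → Even (f m)}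

theorem IsPacked.lt_card {ι : Type*} [Fintype ι] {f : ι → ℕ} (hf : IsPacked f) (i : ι) :
    f i < Fintype.card ι := by
  classical
  have h : Finset.range (f i + 1) ⊆ Finset.univ.image f := by
    intro k hk
    rw [Finset.mem_range, Nat.lt_succ_iff] at hk
    rcases hk.lt_or_eq with hk | rfl
    · obtain ⟨j, hj⟩ := hf i k hk
      exact Finset.mem_image.2 ⟨j, Finset.mem_univ _, hj⟩
    · exact Finset.mem_image_of_mem _ (Finset.mem_univ _)
  have h1 := (Finset.card_le_card h).trans Finset.card_image_le
  simpa using h1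

instance finite_packed (ι : Type*) [Finite ι] : Finite (packed ι) := by
  have := Fintype.ofFinite ι
  refine Set.Finite.to_subtype 
    ((Set.Finite.pi' fun _ : ι => Set.finite_Iio (Fintype.card ι)).subset ?_)
  exact fun f hf i => IsPacked.lt_card hf i

instance finite_evenMin (ι : Type*) [Finite ι] [LinearOrder ι] : Finite (evenMin ι) :=
  Set.Finite.to_subtype ((Set.toFinite (packed ι)).subset fun _ h => h.1)

theorem IsPacked.comp_equiv {ι κ : Type*} {f : ι → ℕ} (hf : IsPacked f) (e : κ ≃ ι) :
    IsPacked (f ∘ e) := by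
  intro i k hk
  obtain ⟨j, hj⟩ := hf (e i) k hk
  exact ⟨e.symm j, by simpa using hj⟩

theorem card_packed_congr {ι κ : Type*} (e : κ ≃ ι) :
    Nat.card (packed ι) = Nat.card (packed κ) := by
  refine Nat.card_congr ⟨fun f => ⟨f.1 ∘ e, IsPacked.comp_equiv f.2 e⟩,
    fun f => ⟨f.1 ∘ e.symm, IsPacked.comp_equiv f.2 e.symm⟩, fun f => ?_, fun f => ?_⟩
  · ext; simp
  · ext; simp

theorem comp_mem_evenMin {ι κ : Type*} [LinearOrder ι] [LinearOrder κ] {f : ι → ℕ}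
    (hf : f ∈ evenMin ι) (e : κ ≃o ι) : f ∘ e ∈ evenMin κ := by
  refine ⟨IsPacked.comp_equiv hf.1 e.toEquiv, fun m hm => hf.2 (e m) fun j hj => ?_⟩
  have := hm (e.symm j) (by rwa [← e.lt_iff_lt, e.apply_symm_apply])
  simpa using this

theorem card_evenMin_congr {ι κ : Type*} [LinearOrder ι] [LinearOrder κ] (e : κ ≃o ι) :
    Nat.card (evenMin ι) = Nat.card (evenMin κ) := by
  refine Nat.card_congr ⟨fun f => ⟨f.1 ∘ e, comp_mem_evenMin f.2 e⟩,
    fun f => ⟨f.1 ∘ e.symm, comp_mem_evenMin f.2 e.symm⟩, fun f => ?_, fun f => ?_⟩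
  · ext; simp
  · ext; simp

/-- The packed function with zero set `S` and given restriction to the complement of `S`. -/
def packedCons {ι : Type*} [DecidableEq ι] (S : Finset ι) (h : {i // i ∉ S} → ℕ) (i : ι) : ℕ :=
  if hi : i ∈ S then 0 else h ⟨i, hi⟩ + 1

theorem packedCons_eq_zero {ι : Type*} [DecidableEq ι] {S : Finset ι} {h : {i // i ∉ S} → ℕ}
    {i : ι} : packedCons S h i = 0 ↔ i ∈ S := by
  unfold packedCons; split_ifs with hi <;> simp [hi]

theorem isPacked_packedCons {ι : Type*} [DecidableEq ι] {S : Finset ι} (hS : S.Nonempty)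
    {h : {i // i ∉ S} → ℕ} (hh : IsPacked h) : IsPacked (packedCons S h) := by
  intro i k hk
  rcases k with _ | k
  · obtain ⟨s, hs⟩ := hS
    exact ⟨s, packedCons_eq_zero.2 hs⟩
  · unfold packedCons at hk
    split_ifs at hk with hi
    · omega
    · obtain ⟨j, hj⟩ := hh ⟨i, hi⟩ k (by omega)
      exact ⟨j, by simp [packedCons, j.2, hj]⟩

/-- Removing the first block, the zero set, and lowering the other indices by one leaves an
arbitrary packed function on the complement. -/
theorem card_packed_eq_sum (ι : Type*) [Fintype ι] [Nonempty ι] [DecidableEq ι] :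
    Nat.card (packed ι) =
      ∑ S : {S : Finset ι // S.Nonempty}, Nat.card (packed {i // i ∉ S.1}) := by
  rw [← Nat.card_sigma]
  symm
  refine Nat.card_congr (Equiv.ofBijective
    (fun p => ⟨packedCons p.1.1 p.2.1, isPacked_packedCons p.1.2 p.2.2⟩) ⟨?_, ?_⟩)
  · rintro ⟨⟨S, hS⟩, h, hh⟩ ⟨⟨S', hS'⟩, h', hh'⟩ heq
    have heq' : packedCons S h = packedCons S' h' := congrArg Subtype.val heq
    have hSS : S = S' := by
      ext i
      rw [← packedCons_eq_zero (h := h), heq', packedCons_eq_zero]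
    subst hSS
    have : h = h' := by
      funext i
      have := congrFun heq' i.1
      simpa [packedCons, i.2] using this
    subst this
    rfl
  · rintro ⟨f, hf⟩
    have hex : ∃ i, f i = 0 := by
      obtain ⟨i⟩ := ‹Nonempty ι›
      rcases Nat.eq_zero_or_pos (f i) with h | h
      · exact ⟨i, h⟩
      · exact hf i 0 h
    refine ⟨⟨⟨Finset.univ.filter (f · = 0), ?_⟩, fun i => f i.1 - 1, ?_⟩, ?_⟩
    · obtain ⟨i, hi⟩ := hex
      exact ⟨i, by simpa using hi⟩
    · intro i k hk
      obtain ⟨j, hj⟩ := hf i (k + 1) (by simp only at hk; omega)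
      exact ⟨⟨j, by simp [hj]⟩, by simp [hj]⟩
    · ext i
      simp only [packedCons, Finset.mem_filter, Finset.mem_univ, true_and]
      split_ifs with h
      · exact h.symm
      · omega

/-! ### Splitting a packed function with even minima at its least element -/

/-- `e` is the even number at which a new block index is opened above the values of `g`:
all values of `g` are at most `e`, and all numbers below `e` are values. -/
def IsEvenTop {ι : Type*} (g : ι → ℕ) (e : ℕ) : Prop :=
  Even e ∧ (∀ i, g i ≤ e) ∧ ∀ k < e, ∃ i, g i = k

/-- If e' < e, parity gives e' + 1 < e, so e' + 1 would be a value of `g` above its bound e'. -/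
theorem IsEvenTop.le {ι : Type*} {g : ι → ℕ} {e e' : ℕ} (h : IsEvenTop g e)
    (h' : IsEvenTop g e') : e ≤ e' := by
  by_contra! hlt
  obtain ⟨a, ha⟩ := h.1
  obtain ⟨a', ha'⟩ := h'.1
  obtain ⟨i, hi⟩ := h.2.2 (e' + 1) (by omega)
  have := h'.2.1 i
  omega

theorem IsEvenTop.unique {ι : Type*} {g : ι → ℕ} {e e' : ℕ} (h : IsEvenTop g e)
    (h' : IsEvenTop g e') : e = e' := le_antisymm (h.le h') (h'.le h)

theorem IsPacked.exists_evenTop {ι : Type*} [Finite ι] {g : ι → ℕ} (hg : IsPacked g) :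
    ∃ e, IsEvenTop g e := by
  rcases isEmpty_or_nonempty ι with h | h
  · exact ⟨0, by simp, fun i => h.elim i, fun k hk => by omega⟩
  -- The parity of the maximum decides whether the new least element joins the last block or opens a
  -- new one.
  · obtain ⟨i, hi⟩ := Finite.exists_max g
    rcases Nat.even_or_odd (g i) with he | ho
    · exact ⟨g i, he, hi, hg i⟩
    · refine ⟨g i + 1, ho.add_one, fun j => (hi j).trans (Nat.le_succ _), fun k hk => ?_⟩
      rcases (Nat.lt_succ_iff.1 hk).lt_or_eq with h | rfl
      · exact hg i k h
      · exact ⟨i, rfl⟩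

/-- The function on `Fin (n + 1)` with value `e` at `0`, given values on `S`, and larger values
elsewhere. -/
def evenMinCons {n : ℕ} (e : ℕ) (S : Finset (Fin n)) (g : {i // i ∈ S} → ℕ)
    (h : {i // i ∉ S} → ℕ) : Fin (n + 1) → ℕ :=
  Fin.cases e fun i => if hi : i ∈ S then g ⟨i, hi⟩ else e + 1 + h ⟨i, hi⟩

section evenMinCons

variable {n e : ℕ} {S : Finset (Fin n)} {g : {i // i ∈ S} → ℕ} {h : {i // i ∉ S} → ℕ}

@[simp]
theorem evenMinCons_zero : evenMinCons e S g h 0 = e := rfl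

theorem evenMinCons_succ_mem {i : Fin n} (hi : i ∈ S) :
    evenMinCons e S g h i.succ = g ⟨i, hi⟩ := by
  simp [evenMinCons, hi]

theorem evenMinCons_succ_not_mem {i : Fin n} (hi : i ∉ S) :
    evenMinCons e S g h i.succ = e + 1 + h ⟨i, hi⟩ := by
  simp [evenMinCons, hi]

theorem evenMinCons_succ_le (he : IsEvenTop g e) {i : Fin n} :
    evenMinCons e S g h i.succ ≤ e ↔ i ∈ S := by
  by_cases hi : i ∈ S
  · simp only [hi, iff_true]
    rw [evenMinCons_succ_mem hi]
    exact he.2.1 _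
  · simp only [hi, iff_false]
    rw [evenMinCons_succ_not_mem hi]
    omega

/-- Once the least element has value `e`, every other left-to-right minimum has value below `e`,
hence lies in `S`. Only `g` is therefore constrained, and `h` can be any packed function. -/
theorem evenMinCons_mem (hg : g ∈ evenMin {i // i ∈ S}) (hh : IsPacked h)
    (he : IsEvenTop g e) : evenMinCons e S g h ∈ evenMin (Fin (n + 1)) := by
  have below : ∀ k < e, ∃ j, evenMinCons e S g h j = k := by
    intro k hk
    obtain ⟨j, hj⟩ := he.2.2 k hk
    exact ⟨j.1.succ, by rw [evenMinCons_succ_mem j.2, hj]⟩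
  refine ⟨fun i k hk => ?_, fun m hm => ?_⟩
  · rcases lt_trichotomy k e with hlt | rfl | hgt
    · exact below k hlt
    · exact ⟨0, rfl⟩
    · induction i using Fin.cases with
      | zero => rw [evenMinCons_zero] at hk; omega
      | succ i =>
        by_cases hi : i ∈ S
        · have := (evenMinCons_succ_le (h := h) he).2 hi
          omega
        · rw [evenMinCons_succ_not_mem hi] at hk
          obtain ⟨j, hj⟩ := hh ⟨i, hi⟩ (k - e - 1) (by omega)
          exact ⟨j.1.succ, by rw [evenMinCons_succ_not_mem j.2, hj]; omega⟩
  · induction m using Fin.cases with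
    | zero => exact he.1
    | succ i =>
      have h0 := hm 0 (Fin.succ_pos i)
      rw [evenMinCons_zero] at h0
      have hi : i ∈ S := (evenMinCons_succ_le he).1 h0.le
      rw [evenMinCons_succ_mem hi]
      refine hg.2 _ fun j hj => ?_
      have := hm j.1.succ (Fin.succ_lt_succ_iff.2 hj)
      rwa [evenMinCons_succ_mem hi, evenMinCons_succ_mem j.2] at this

end evenMinCons

/-- The elements with index at most that of 0 form a function with even minima, and those above it
an arbitrary packed function. The value at 0 carries no further information, being the even top of
the lower part. -/
theorem card_evenMin_succ (n : ℕ) :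
    Nat.card (evenMin (Fin (n + 1))) = ∑ S : Finset (Fin n),
      Nat.card (evenMin {i // i ∈ S}) * Nat.card (packed {i // i ∉ S}) := by
  simp_rw [← Nat.card_prod]
  rw [← Nat.card_sigma]
  symm
  choose! top htop using fun (S : Finset (Fin n)) (g : {i // i ∈ S} → ℕ) (hg : IsPacked g) =>
    hg.exists_evenTop
  refine Nat.card_congr (Equiv.ofBijective
    (fun p => ⟨evenMinCons (top p.1 p.2.1.1) p.1 p.2.1.1 p.2.2.1,
      evenMinCons_mem p.2.1.2 p.2.2.2 (htop _ _ p.2.1.2.1)⟩) ⟨?_, ?_⟩)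
  · rintro ⟨S, ⟨g, hg⟩, h, hh⟩ ⟨S', ⟨g', hg'⟩, h', hh'⟩ heq
    have heq' : evenMinCons (top S g) S g h = evenMinCons (top S' g') S' g' h' :=
      congrArg Subtype.val heq
    have htt : top S g = top S' g' := congrFun heq' 0
    have hSS : S = S' := by
      ext i
      rw [← evenMinCons_succ_le (h := h) (htop S g hg.1), heq', htt,
        evenMinCons_succ_le (htop S' g' hg'.1)]
    subst hSS
    have hgg : g = g' := by
      funext i
      have := congrFun heq' i.1.succ
      rwa [evenMinCons_succ_mem i.2, evenMinCons_succ_mem i.2] at this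
    subst hgg
    have hhh : h = h' := by
      funext i
      have := congrFun heq' i.1.succ
      rw [evenMinCons_succ_not_mem i.2, evenMinCons_succ_not_mem i.2] at this
      exact Nat.add_left_cancel this
    subst hhh
    rfl
  · rintro ⟨f, hf⟩
    have hf0 : Even (f 0) := hf.2 0 fun j hj => absurd hj (Fin.not_lt_zero j)
    let S : Finset (Fin n) := Finset.univ.filter fun i => f i.succ ≤ f 0
    have hS : ∀ i, i ∈ S ↔ f i.succ ≤ f 0 := by simp [S]
    let g : {i // i ∈ S} → ℕ := fun i => f i.1.succ
    let h : {i // i ∉ S} → ℕ := fun i => f i.1.succ - f 0 - 1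
    have below : ∀ k < f 0, ∃ i, g i = k := by
      intro k hk
      obtain ⟨j, hj⟩ := hf.1 0 k hk
      induction j using Fin.cases with
      | zero => omega
      | succ j => exact ⟨⟨j, (hS j).2 (by omega)⟩, hj⟩
    have hg : g ∈ evenMin {i // i ∈ S} := by
      refine ⟨fun i k hk => below k (hk.trans_le ((hS i).1 i.2)), fun m hm => ?_⟩
      rcases ((hS m).1 m.2).lt_or_eq with hlt | heq
      · refine hf.2 m.1.succ fun j hj => ?_
        induction j using Fin.cases with
        | zero => exact hlt
        | succ j =>
          by_cases hjS : j ∈ S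
          · exact hm ⟨j, hjS⟩ (Fin.succ_lt_succ_iff.1 hj)
          · rw [hS] at hjS
            omega
      -- An element in the block of 0 may be a minimum for `g` without being one for `f`; its value
      -- is even because it equals `f 0`.
      · change Even (f m.1.succ)
        rwa [heq]
    have hh : IsPacked h := by
      intro i k hk
      obtain ⟨j, hj⟩ := hf.1 i.1.succ (k + f 0 + 1) (by simp only [h] at hk; omega)
      induction j using Fin.cases with
      | zero => omega
      | succ j =>
        refine ⟨⟨j, by rw [hS]; omega⟩, ?_⟩
        simp only [h]
        omega
    have ht : top S g = f 0 :=
      (htop S g hg.1).unique ⟨hf0, fun i => (hS i).1 i.2, below⟩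
    refine ⟨⟨S, ⟨g, hg⟩, h, hh⟩, ?_⟩
    ext i
    change evenMinCons (top S g) S g h i = f i
    rw [ht]
    induction i using Fin.cases with
    | zero => rfl
    | succ i =>
      by_cases hi : i ∈ S
      · rw [evenMinCons_succ_mem hi]
      · rw [evenMinCons_succ_not_mem hi]
        rw [hS] at hi
        simp only [h]
        omega

theorem card_evenMin_subtype {n : ℕ} (S : Finset (Fin n)) :
    Nat.card (evenMin {i // i ∈ S}) = Nat.card (evenMin (Fin S.card)) :=
  card_evenMin_congr (S.orderIsoOfFin rfl)

theorem card_packed_compl {n : ℕ} (S : Finset (Fin n)) :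
    Nat.card (packed {i // i ∉ S}) = Nat.card (packed (Fin (n - S.card))) := by
  refine card_packed_congr (Fintype.equivOfCardEq ?_).symm
  rw [Fintype.card_fin, Fintype.card_subtype_compl, Fintype.card_fin, Fintype.card_coe]

theorem card_evenMin_succ_eq_sum_choose (n : ℕ) :
    Nat.card (evenMin (Fin (n + 1))) = ∑ k ∈ Finset.range (n + 1),
      n.choose k * (Nat.card (evenMin (Fin k)) * Nat.card (packed (Fin (n - k)))) := by
  rw [card_evenMin_succ]
  simp_rw [card_evenMin_subtype, card_packed_compl]
  have := Finset.sum_powerset_apply_card (x := (Finset.univ : Finset (Fin n)))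
    (fun k => Nat.card (evenMin (Fin k)) * Nat.card (packed (Fin (n - k))))
  simpa only [Finset.powerset_univ, Finset.card_univ, Fintype.card_fin, smul_eq_mul] using this

/-- On the right, the empty set contributes one copy of the count; for n > 0 the nonempty sets, as
first blocks, contribute the other. The correction at n = 0 accounts for the empty function, which
has no first block. -/
theorem two_mul_card_packed (n : ℕ) :
    2 * Nat.card (packed (Fin n)) = (if n = 0 then 1 else 0) +
      ∑ k ∈ Finset.range (n + 1), n.choose k * Nat.card (packed (Fin (n - k))) := by
  rcases n with _ | n
  · have : Nat.card (packed (Fin 0)) = 1 := by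
      have : Unique (packed (Fin 0)) :=
        ⟨⟨⟨Fin.elim0, fun i => i.elim0⟩⟩, fun f => by ext i; exact i.elim0⟩
      exact Nat.card_unique
    simp only [zero_add, Finset.sum_range_one, Nat.choose_self, Nat.sub_zero, this]
    rfl
  · have h := Finset.sum_powerset_apply_card (x := (Finset.univ : Finset (Fin (n + 1))))
      (fun k => Nat.card (packed (Fin (n + 1 - k))))
    simp only [Finset.powerset_univ, Finset.card_univ, Fintype.card_fin, smul_eq_mul] at h
    rw [← h, ← Finset.add_sum_erase _ _ (Finset.mem_univ ∅), two_mul]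
    simp only [Nat.succ_ne_zero, if_false, zero_add, Finset.card_empty, Nat.sub_zero]
    congr 1
    rw [card_packed_eq_sum]
    simp_rw [card_packed_compl]
    rw [Finset.sum_subtype (Finset.univ.erase ∅)
      (p := fun S : Finset (Fin (n + 1)) => S.Nonempty)]
    intro S
    simp [Finset.nonempty_iff_ne_empty]

/-! ### Generating functions -/

open PowerSeries in
theorem coeff_egf_mul (a b : ℕ → ℕ) (n : ℕ) :
    coeff n (egf a * egf b) =
      ((∑ k ∈ Finset.range (n + 1), n.choose k * (a k * b (n - k)) : ℕ) : ℚ) / n.factorial := by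
  rw [coeff_mul, Finset.Nat.sum_antidiagonal_eq_sum_range_succ_mk, Nat.cast_sum,
    Finset.sum_div]
  refine Finset.sum_congr rfl fun k hk => ?_
  have hk' : k ≤ n := Nat.lt_succ_iff.1 (Finset.mem_range.1 hk)
  have h0 : (n.factorial : ℚ) ≠ 0 := by positivity
  have h1 : (k.factorial : ℚ) ≠ 0 := by positivity
  have h2 : ((n - k).factorial : ℚ) ≠ 0 := by positivity
  have h := Nat.choose_mul_factorial_mul_factorial hk'
  have h' : (n.choose k : ℚ) * k.factorial * (n - k).factorial = n.factorial := by
    exact_mod_cast h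
  simp only [egf, coeff_mk]
  push_cast
  rw [← h']
  rw [← h'] at h0
  have h3 : (n.choose k : ℚ) ≠ 0 := fun h => h0 (by simp [h])
  field_simp

theorem exp_eq_egf : PowerSeries.exp ℚ = egf fun _ => 1 := by
  ext n
  simp [egf, PowerSeries.coeff_exp]

theorem derivative_egf (b : ℕ → ℕ) :
    PowerSeries.derivative ℚ (egf b) = egf fun n => b (n + 1) := by
  ext n
  rw [PowerSeries.coeff_derivative]
  simp only [egf, PowerSeries.coeff_mk, Nat.factorial_succ]
  push_cast
  have h0 : (n.factorial : ℚ) ≠ 0 := by positivity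
  have h1 : (n + 1 : ℚ) ≠ 0 := by positivity
  field_simp

/-- The exponential generating function of the packed functions. -/
noncomputable def packedEgf : PowerSeries ℚ := egf fun n => Nat.card (packed (Fin n))

/-- The exponential generating function of the packed functions with even minima. -/
noncomputable def evenMinEgf : PowerSeries ℚ := egf fun n => Nat.card (evenMin (Fin n))

theorem card_evenMin_zero : Nat.card (evenMin (Fin 0)) = 1 := by
  have : Unique (evenMin (Fin 0)) :=
    ⟨⟨⟨Fin.elim0, fun i => i.elim0, fun i => i.elim0⟩⟩, fun f => by ext i; exact i.elim0⟩
  exact Nat.card_unique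

theorem packedEgf_mul : (2 - PowerSeries.exp ℚ) * packedEgf = 1 := by
  have h : 2 * packedEgf = 1 + PowerSeries.exp ℚ * packedEgf := by
    ext n
    rw [exp_eq_egf, packedEgf, map_add, coeff_egf_mul, two_mul, map_add, PowerSeries.coeff_one,
      ← two_mul]
    have h := two_mul_card_packed n
    have h' : (2 : ℚ) * Nat.card (packed (Fin n)) = (if n = 0 then 1 else 0) +
      ((∑ k ∈ Finset.range (n + 1), n.choose k * Nat.card (packed (Fin (n - k))) : ℕ) : ℚ) := by
      rw [← Nat.cast_ofNat, ← Nat.cast_mul, h]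
      push_cast
      rfl
    simp only [egf, PowerSeries.coeff_mk, one_mul]
    rw [← mul_div_assoc, h', add_div]
    congr 1
    split_ifs with h0
    · simp [h0]
    · simp
  rw [sub_mul, h]
  ring

theorem derivative_evenMinEgf :
    PowerSeries.derivative ℚ evenMinEgf = packedEgf * evenMinEgf := by
  rw [evenMinEgf, derivative_egf, mul_comm]
  ext n
  rw [packedEgf, coeff_egf_mul, ← card_evenMin_succ_eq_sum_choose]
  simp [egf]

theorem derivative_exp : PowerSeries.derivative ℚ (PowerSeries.exp ℚ) = PowerSeries.exp ℚ := by
  rw [exp_eq_egf, derivative_egf]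

/-- Differentiating (2 - eˣ)P = 1 gives (2 - eˣ)P' = eˣP; multiplication by P removes the factor 2 -
eˣ. -/
theorem derivative_packedEgf : PowerSeries.derivative ℚ packedEgf =
    PowerSeries.exp ℚ * packedEgf ^ 2 := by
  have h := congrArg (PowerSeries.derivative ℚ) packedEgf_mul
  have h2 : PowerSeries.derivative ℚ (2 : PowerSeries ℚ) = 0 := by
    simpa using Derivation.map_natCast (PowerSeries.derivative ℚ) 2
  simp only [Derivation.leibniz, map_sub, derivative_exp, h2, smul_eq_mul,
    Derivation.map_one_eq_zero] at h
  have h1 := packedEgf_mul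
  linear_combination packedEgf * h - (PowerSeries.derivative ℚ packedEgf) * h1

theorem constantCoeff_packedEgf : PowerSeries.constantCoeff packedEgf = 1 := by
  have h := congrArg PowerSeries.constantCoeff packedEgf_mul
  simp only [map_mul, map_sub, PowerSeries.constantCoeff_exp, map_one, map_ofNat] at h
  linarith

theorem constantCoeff_evenMinEgf : PowerSeries.constantCoeff evenMinEgf = 1 := by
  rw [← PowerSeries.coeff_zero_eq_constantCoeff_apply]
  rw [evenMinEgf, egf, PowerSeries.coeff_mk, card_evenMin_zero]
  simp

/-- Since E' = PE and (2 - eˣ)P = 1, the series E²(2 - eˣ)e⁻ˣ has derivative 0. Its constant term is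
1, so it equals 1, and E² = eˣP follows. -/
theorem evenMinEgf_sq : evenMinEgf ^ 2 = PowerSeries.exp ℚ * packedEgf := by
  have hE : PowerSeries.exp ℚ * PowerSeries.evalNegHom (PowerSeries.exp ℚ) = 1 :=
    PowerSeries.exp_mul_exp_neg_eq_one
  set E := PowerSeries.exp ℚ
  set E' := PowerSeries.evalNegHom E
  have h := packedEgf_mul
  have hE' : PowerSeries.derivative ℚ E' = -E' := by
    have h := congrArg (PowerSeries.derivative ℚ) hE
    simp only [Derivation.leibniz, smul_eq_mul, Derivation.map_one_eq_zero, E,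
      derivative_exp] at h
    linear_combination E' * h - (PowerSeries.derivative ℚ E' + E') * hE
  have h2 : PowerSeries.derivative ℚ (2 : PowerSeries ℚ) = 0 := by
    simpa using Derivation.map_natCast (PowerSeries.derivative ℚ) 2
  have key : evenMinEgf ^ 2 * ((2 - E) * E') = 1 := by
    apply PowerSeries.derivative.ext
    · simp only [Derivation.leibniz, Derivation.leibniz_pow, smul_eq_mul, map_sub, hE', h2, E,
        derivative_exp, derivative_evenMinEgf, Derivation.map_one_eq_zero]
      simp only [nsmul_eq_mul]
      linear_combination (2 * evenMinEgf ^ 2 * E') * h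
    · have : PowerSeries.constantCoeff E' = 1 := by
        have h := congrArg PowerSeries.constantCoeff hE
        simpa [E] using h
      simp only [map_mul, map_pow, map_sub, map_ofNat, constantCoeff_evenMinEgf, this, E,
        PowerSeries.constantCoeff_exp, map_one]
      norm_num
  linear_combination E * packedEgf * key - evenMinEgf ^ 2 * (E * E') * h - evenMinEgf ^ 2 * hE

theorem isPowerSeriesSqrt_evenMinEgf :
    IsPowerSeriesSqrt evenMinEgf (PowerSeries.exp ℚ * (2 - PowerSeries.exp ℚ)⁻¹) := by
  refine ⟨?_, constantCoeff_evenMinEgf⟩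
  rw [evenMinEgf_sq]
  congr 1
  rw [PowerSeries.eq_inv_iff_mul_eq_one, mul_comm, packedEgf_mul]
  rw [map_sub, PowerSeries.constantCoeff_exp, map_ofNat]
  norm_num

/-- Substituting E² = eˣP into P' = eˣP² turns the derivative of PᵃEᵇ into a PᵃEᵇ⁺² + b Pᵃ⁺¹Eᵇ, the
recursion of `pathCount`. Both series have constant term 1, which is the base case. -/
theorem constantCoeff_iterate_derivative (n a b : ℕ) :
    PowerSeries.constantCoeff ((PowerSeries.derivative ℚ)^[n] (packedEgf ^ a * evenMinEgf ^ b)) =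
      pathCount n a b := by
  induction n generalizing a b with
  | zero => simp [pathCount, constantCoeff_packedEgf, constantCoeff_evenMinEgf]
  | succ n ih =>
    have hadd : ∀ (m : ℕ) (f g : PowerSeries ℚ), (PowerSeries.derivative ℚ)^[m] (f + g) =
        (PowerSeries.derivative ℚ)^[m] f + (PowerSeries.derivative ℚ)^[m] g :=
      fun m f g => iterate_map_add _ m f g
    have hsmul : ∀ (m c : ℕ) (f : PowerSeries ℚ), (PowerSeries.derivative ℚ)^[m] (c • f) =
        c • (PowerSeries.derivative ℚ)^[m] f :=
      fun m c f => by
        induction m with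
        | zero => rfl
        | succ m ih => simp only [Function.iterate_succ_apply', ih, map_nsmul]
    have hstep : PowerSeries.derivative ℚ (packedEgf ^ a * evenMinEgf ^ b) =
        a • (packedEgf ^ a * evenMinEgf ^ (b + 2)) +
          b • (packedEgf ^ (a + 1) * evenMinEgf ^ b) := by
      have h := evenMinEgf_sq
      rcases a with _ | a <;> rcases b with _ | b <;>
      simp only [Derivation.leibniz, Derivation.leibniz_pow, smul_eq_mul, derivative_packedEgf,
        derivative_evenMinEgf, nsmul_eq_mul, Nat.add_sub_cancel, pow_zero, Nat.cast_zero,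
        Derivation.map_one_eq_zero, Nat.cast_add, Nat.cast_one, zero_add]
      · ring
      · ring
      · linear_combination (-(a + 1) * packedEgf ^ (a + 1)) * h
      · linear_combination (-(a + 1) * packedEgf ^ (a + 1) * evenMinEgf ^ (b + 1)) * h
    rw [Function.iterate_succ_apply, hstep, hadd, hsmul, hsmul, map_add, map_nsmul, map_nsmul,
      ih, ih, pathCount]
    simp

theorem constantCoeff_iterate_derivative_egf (b : ℕ → ℕ) (n : ℕ) :
    PowerSeries.constantCoeff ((PowerSeries.derivative ℚ)^[n] (egf b)) = b n := by
  induction n generalizing b with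
  | zero => rw [← PowerSeries.coeff_zero_eq_constantCoeff_apply]; simp [egf]
  | succ n ih => rw [Function.iterate_succ_apply, derivative_egf, ih]

theorem card_evenMin (n : ℕ) : Nat.card (evenMin (Fin n)) = pathCount n 0 1 := by
  have h1 := constantCoeff_iterate_derivative n 0 1
  rw [pow_zero, one_mul, pow_one, evenMinEgf, constantCoeff_iterate_derivative_egf] at h1
  exact_mod_cast h1

/-! ### Generating trees -/

/-- `ext` lists the children of an object. `hX` and `huniq` make each level the disjoint union of
the families of children of the previous level, and `hsum` says, through an arbitrary test function,
how the statistics of the children are distributed. -/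
theorem encard_eq_pathCount {γ : ℕ → Type*} (X : ∀ n, Set (γ n))
    (ext : ∀ n, γ n → Finset (γ (n + 1))) (stat : ∀ n, γ n → ℕ × ℕ)
    (x₀ : γ 0) (hX₀ : X 0 = {x₀}) (hstat₀ : stat 0 x₀ = (0, 1))
    (hX : ∀ n y, y ∈ X (n + 1) ↔ ∃ x ∈ X n, y ∈ ext n x)
    (huniq : ∀ n, ∀ x ∈ X n, ∀ x' ∈ X n, ∀ y, y ∈ ext n x → y ∈ ext n x' → x = x')
    (hsum : ∀ n, ∀ x ∈ X n, ∀ g : ℕ → ℕ → ℕ,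
      ∑ y ∈ ext n x, g (stat (n + 1) y).1 (stat (n + 1) y).2 =
        (stat n x).1 * g (stat n x).1 ((stat n x).2 + 2) +
          (stat n x).2 * g ((stat n x).1 + 1) (stat n x).2) (n : ℕ) :
    (X n).encard = pathCount n 0 1 := by
  classical
  -- Counting descendants m levels further down makes the induction go through; m = 0 gives the
  -- cardinality.
  have key : ∀ n, ∃ D : Finset (γ n), (D : Set (γ n)) = X n ∧
      ∀ m, ∑ x ∈ D, pathCount m (stat n x).1 (stat n x).2 = pathCount (n + m) 0 1 := by
    intro n
    induction n with
    | zero => exact ⟨{x₀}, by simp [hX₀], fun m => by simp [hstat₀]⟩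
    | succ n ih =>
      obtain ⟨D, hD, hDsum⟩ := ih
      have hmem : ∀ x, x ∈ D ↔ x ∈ X n := fun x => by rw [← hD, Finset.mem_coe]
      refine ⟨D.biUnion (ext n), ?_, fun m => ?_⟩
      · ext y
        simp [hX, hmem]
      · rw [Finset.sum_biUnion]
        · rw [show n + 1 + m = n + (m + 1) by omega, ← hDsum]
          refine Finset.sum_congr rfl fun x hx => ?_
          rw [hsum n x ((hmem x).1 hx) (pathCount m)]
          rfl
        · intro x hx x' hx' hne
          rw [Function.onFun, Finset.disjoint_left]
          exact fun y hy hy' => hne (huniq n x ((hmem x).1 hx) x' ((hmem x').1 hx') y hy hy')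
  obtain ⟨D, hD, hDsum⟩ := key n
  have h := hDsum 0
  simp only [pathCount, Finset.sum_const, smul_eq_mul, mul_one, add_zero] at h
  rw [← hD, Set.encard_coe_eq_coe_finsetCard, h]

/-! ### Codes with a plus before each minus -/

namespace BuildTreeCode

variable {n : ℕ}

/-- `v⁺` occurs in the code. -/
def HasPlus (c : BuildTreeCode n) (v : ℕ) : Prop := ∃ j, c.a j = v ∧ c.σ j = 1

/-- The pairs that may be appended to a code with a plus before each minus. -/
noncomputable def options (c : BuildTreeCode n) : Finset (ℕ × ℤˣ) := by
  classical
  exact (Finset.range (n + 1) ×ˢ Finset.univ).filter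
    fun p => p.2 = -1 → p.1 ≠ 0 ∧ c.HasPlus p.1

theorem mem_options {c : BuildTreeCode n} {p : ℕ × ℤˣ} :
    p ∈ c.options ↔ p.1 ≤ n ∧ (p.2 = -1 → p.1 ≠ 0 ∧ c.HasPlus p.1) := by
  simp only [options, Finset.mem_filter, Finset.mem_product, Finset.mem_range, Finset.mem_univ,
    and_true, Nat.lt_succ_iff]

/-- Append a pair to a code; the pair is replaced by `(0, 1)` if it is not allowed. -/
noncomputable def append (c : BuildTreeCode n) (p : ℕ × ℤˣ) : BuildTreeCode (n + 1) := by
  classical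
  exact if h : p ∈ c.options then
    { a := Fin.snoc c.a p.1
      σ := Fin.snoc c.σ p.2
      a_le := fun i => by
        induction i using Fin.lastCases with
        | last => simpa using (mem_options.1 h).1
        | cast i => simpa using c.a_le i
      ne_zero_neg := fun i => by
        induction i using Fin.lastCases with
        | last =>
          simp only [Fin.snoc_last, ne_eq, Prod.mk.injEq]
          exact fun h' => ((mem_options.1 h).2 h'.2).1 h'.1
        | cast i => simpa using c.ne_zero_neg i }
  else
    { a := Fin.snoc c.a 0
      σ := Fin.snoc c.σ 1
      a_le := fun i => by
        induction i using Fin.lastCases with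
        | last => simp
        | cast i => simpa using c.a_le i
      ne_zero_neg := fun i => by
        induction i using Fin.lastCases with
        | last => simp
        | cast i => simpa using c.ne_zero_neg i }

variable {c : BuildTreeCode n} {p : ℕ × ℤˣ}

theorem append_a (h : p ∈ c.options) : (c.append p).a = Fin.snoc (α := fun _ => ℕ) c.a p.1 := by
  simp [append, h]

theorem append_σ (h : p ∈ c.options) : (c.append p).σ = Fin.snoc (α := fun _ => ℤˣ) c.σ p.2 := by
  simp [append, h]

theorem append_injOn : Set.InjOn c.append c.options := by
  intro p hp q hq h
  have h1 := congrArg (fun d => d.a (Fin.last n)) h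
  have h2 := congrArg (fun d => d.σ (Fin.last n)) h
  simp only [append_a hp, append_a hq, append_σ hp, append_σ hq, Fin.snoc_last] at h1 h2
  exact Prod.ext h1 h2

theorem hasPlus_append (h : p ∈ c.options) {v : ℕ} :
    (c.append p).HasPlus v ↔ c.HasPlus v ∨ (p.1 = v ∧ p.2 = 1) := by
  simp only [HasPlus, append_a h, append_σ h]
  constructor
  · rintro ⟨j, hj⟩
    induction j using Fin.lastCases with
    | last => right; simpa using hj
    | cast j => left; exact ⟨j, by simpa using hj⟩
  · rintro (⟨j, hj⟩ | hj)
    · exact ⟨j.castSucc, by simpa using hj⟩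
    · exact ⟨Fin.last n, by simpa using hj⟩

/-- Removing the last entry. -/
def init (d : BuildTreeCode (n + 1)) : BuildTreeCode n where
  a := Fin.init d.a
  σ := Fin.init d.σ
  a_le i := d.a_le i.castSucc
  ne_zero_neg i := d.ne_zero_neg i.castSucc

theorem init_append (h : p ∈ c.options) : (c.append p).init = c := by
  ext i
  · simp [init, append_a h]
  · simp [init, append_σ h]

open Classical in
/-- The numbers `1 ≤ v ≤ n` for which `v⁺` does not occur. -/
noncomputable def lacking (c : BuildTreeCode n) : Finset ℕ :=
  (Finset.Icc 1 n).filter fun v => ¬ c.HasPlus v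

theorem mem_lacking {v : ℕ} : v ∈ c.lacking ↔ (1 ≤ v ∧ v ≤ n) ∧ ¬ c.HasPlus v := by
  simp [lacking]

theorem card_lacking_le : c.lacking.card ≤ n := by
  classical
  have h : c.lacking ⊆ Finset.Icc 1 n := Finset.filter_subset _ _
  simpa using Finset.card_le_card h

theorem succ_not_hasPlus : ¬ c.HasPlus (n + 1) := by
  rintro ⟨j, hj, -⟩
  have := c.a_le j
  omega

/-- Appending always makes the new value n + 1 lacking, since it exceeds all admissible entries. The
only compensation comes from a first occurrence of some v⁺ with v ≥ 1. -/
theorem card_lacking_append (h : p ∈ c.options) :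
    (c.append p).lacking.card =
      if p.1 ∈ c.lacking ∧ p.2 = 1 then c.lacking.card else c.lacking.card + 1 := by
  have hins : (c.append p).lacking = (if p.1 ∈ c.lacking ∧ p.2 = 1 then c.lacking.erase p.1
      else c.lacking) ∪ {n + 1} := by
    ext v
    have hp := (mem_options.1 h).1
    have hs : v = n + 1 → ¬ c.HasPlus v := fun h => h ▸ succ_not_hasPlus
    split_ifs with hc
    · simp only [mem_lacking, hasPlus_append h, Finset.mem_union, Finset.mem_erase,
        Finset.mem_singleton]
      rcases hc with ⟨hc, hc2⟩
      rw [mem_lacking] at hc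
      grind
    · simp only [mem_lacking, hasPlus_append h, Finset.mem_union, Finset.mem_singleton]
      rw [mem_lacking] at hc
      grind
  have hn : n + 1 ∉ c.lacking := fun h => by have := (mem_lacking.1 h).1.2; omega
  rw [hins]
  split_ifs with hc
  · rw [Finset.card_union_of_disjoint (by simp [hn]), Finset.card_singleton,
      Finset.card_erase_add_one hc.1]
  · rw [Finset.card_union_of_disjoint (by simpa using hn), Finset.card_singleton]

/-- There are n + 1 options with sign plus, and one with sign minus for each v in 1, …, n that is
not lacking. -/
theorem card_options (c : BuildTreeCode n) : c.options.card + c.lacking.card = 2 * n + 1 := by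
  classical
  have h : c.options = (Finset.range (n + 1) ×ˢ {1}) ∪ ((Finset.Icc 1 n \ c.lacking) ×ˢ {-1}) := by
    ext ⟨v, s⟩
    simp only [mem_options, Finset.mem_union, Finset.mem_product, Finset.mem_range,
      Finset.mem_singleton, Finset.mem_sdiff, Finset.mem_Icc, mem_lacking]
    rcases Int.units_eq_one_or s with rfl | rfl
    · simp [show (1 : ℤˣ) ≠ -1 by decide]
    · simp only [show (-1 : ℤˣ) ≠ 1 by decide]
      grind
  have hsub : c.lacking ⊆ Finset.Icc 1 n := Finset.filter_subset _ _
  have hle := card_lacking_le (c := c)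
  rw [h, Finset.card_union_of_disjoint, Finset.card_product, Finset.card_product,
    Finset.card_sdiff_of_subset hsub]
  · simp
    omega
  · rw [Finset.disjoint_left]
    rintro ⟨v, s⟩ h1 h2
    simp only [Finset.mem_product, Finset.mem_singleton] at h1 h2
    exact absurd (h1.2.symm.trans h2.2) (by decide)

theorem sum_options (c : BuildTreeCode n) (g : ℕ → ℕ) :
    ∑ p ∈ c.options, g (c.append p).lacking.card =
      c.lacking.card * g c.lacking.card +
        (2 * n + 1 - 2 * c.lacking.card) * g (c.lacking.card + 1) := by
  classical
  have h1 : c.options.filter (fun p => p.1 ∈ c.lacking ∧ p.2 = 1) = c.lacking ×ˢ {1} := by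
    ext ⟨v, s⟩
    simp only [mem_options, Finset.mem_filter, Finset.mem_product, Finset.mem_singleton]
    constructor
    · exact fun h => h.2
    · rintro ⟨hv, rfl⟩
      exact ⟨⟨(mem_lacking.1 hv).1.2, fun h => absurd h (by decide)⟩, hv, rfl⟩
  have hcard := Finset.card_filter_add_card_filter_not (s := c.options)
    (fun p => p.1 ∈ c.lacking ∧ p.2 = 1)
  rw [h1, Finset.card_product, Finset.card_singleton, mul_one] at hcard
  have ho := c.card_options
  rw [Finset.sum_congr rfl fun p hp => congrArg g (card_lacking_append hp)]
  simp_rw [apply_ite g]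
  rw [Finset.sum_ite, Finset.sum_const, Finset.sum_const, h1, Finset.card_product,
    Finset.card_singleton, mul_one, smul_eq_mul, smul_eq_mul]
  congr 2
  omega

theorem append_mem_plusBeforeCodes (h : p ∈ c.options) (hc : c ∈ plusBeforeCodes n) :
    c.append p ∈ plusBeforeCodes (n + 1) := by
  intro i
  simp only [append_a h, append_σ h]
  induction i using Fin.lastCases with
  | last =>
    intro hi
    simp only [Fin.snoc_last] at hi
    obtain ⟨-, j, hj⟩ := (mem_options.1 h).2 hi
    exact ⟨j.castSucc, Fin.castSucc_lt_last j, by simpa using hj⟩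
  | cast i =>
    intro hi
    simp only [Fin.snoc_castSucc] at hi
    obtain ⟨j, hji, hj⟩ := hc i hi
    exact ⟨j.castSucc, by simpa using hji, by simpa using hj⟩

theorem exists_append_of_mem_plusBeforeCodes {d : BuildTreeCode (n + 1)}
    (hd : d ∈ plusBeforeCodes (n + 1)) :
    d.init ∈ plusBeforeCodes n ∧ ∃ p ∈ d.init.options, d.init.append p = d := by
  refine ⟨fun i hi => ?_, (d.a (Fin.last n), d.σ (Fin.last n)), ?_⟩
  · obtain ⟨j, hji, hj⟩ := hd i.castSucc hi
    have hjl : j ≠ Fin.last n := fun h => by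
      subst h
      exact absurd hji (not_lt.2 (Fin.le_last _))
    obtain ⟨j, rfl⟩ := Fin.exists_castSucc_eq.2 hjl
    exact ⟨j, by simpa using hji, hj⟩
  · have hp : (d.a (Fin.last n), d.σ (Fin.last n)) ∈ d.init.options := by
      refine mem_options.2 ⟨by simpa using d.a_le (Fin.last n), fun h => ⟨fun h0 => ?_, ?_⟩⟩
      · exact d.ne_zero_neg (Fin.last n) (Prod.ext h0 h)
      · obtain ⟨j, hji, hj⟩ := hd (Fin.last n) h
        obtain ⟨j, rfl⟩ := Fin.exists_castSucc_eq.2 hji.ne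
        exact ⟨j, hj⟩
    refine ⟨hp, ?_⟩
    ext i
    · rw [append_a hp]
      induction i using Fin.lastCases <;> simp [init, Fin.init]
    · rw [append_σ hp]
      induction i using Fin.lastCases <;> simp [init, Fin.init]

end BuildTreeCode

theorem encard_plusBeforeCodes (n : ℕ) : (plusBeforeCodes n).encard = pathCount n 0 1 := by
  classical
  refine encard_eq_pathCount plusBeforeCodes (fun n c => c.options.image c.append)
    (fun n c => (c.lacking.card, 2 * n + 1 - 2 * c.lacking.card))
    ⟨Fin.elim0, Fin.elim0, fun i => i.elim0, fun i => i.elim0⟩ ?_ ?_ ?_ ?_ ?_ n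
  · ext c
    simp only [Set.mem_singleton_iff]
    exact ⟨fun _ => by ext i <;> exact i.elim0, fun _ i => i.elim0⟩
  · simp [BuildTreeCode.lacking]
  · intro n d
    simp only [Finset.mem_image]
    constructor
    · intro hd
      exact ⟨d.init, BuildTreeCode.exists_append_of_mem_plusBeforeCodes hd⟩
    · rintro ⟨c, hc, p, hp, rfl⟩
      exact BuildTreeCode.append_mem_plusBeforeCodes hp hc
  · intro n c _ c' _ d hd hd'
    obtain ⟨p, hp, rfl⟩ := Finset.mem_image.1 hd
    obtain ⟨p', hp', h⟩ := Finset.mem_image.1 hd'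
    rw [← BuildTreeCode.init_append hp, ← h, BuildTreeCode.init_append hp']
  · intro n c _ g
    rw [Finset.sum_image BuildTreeCode.append_injOn]
    have hle := BuildTreeCode.card_lacking_le (c := c)
    rw [BuildTreeCode.sum_options c fun k => g k (2 * (n + 1) + 1 - 2 * k)]
    rcases hle.lt_or_eq with hlt | heq
    · rw [show 2 * (n + 1) + 1 - 2 * c.lacking.card = 2 * n + 1 - 2 * c.lacking.card + 2 by omega,
        show 2 * (n + 1) + 1 - 2 * (c.lacking.card + 1) = 2 * n + 1 - 2 * c.lacking.card by omega]
    · rw [heq]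
      rw [show 2 * (n + 1) + 1 - 2 * n = 2 * n + 1 - 2 * n + 2 by omega,
        show 2 * (n + 1) + 1 - 2 * (n + 1) = 2 * n + 1 - 2 * n by omega]

/-! ### Codes with a plus after each minus -/

section fiberSwap

variable {n : ℕ} (a : Fin n → ℕ)

/-- The positions at which `a` takes the same value as at `i`. -/
def fiber (i : Fin n) : Finset (Fin n) := Finset.univ.filter (a · = a i)

theorem self_mem_fiber (i : Fin n) : i ∈ fiber a i := by simp [fiber]

/-- The first position at which `a` takes the same value as at `i`. -/
def firstInFiber (i : Fin n) : Fin n := (fiber a i).min' ⟨i, self_mem_fiber a i⟩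

/-- The last position at which `a` takes the same value as at `i`. -/
def lastInFiber (i : Fin n) : Fin n := (fiber a i).max' ⟨i, self_mem_fiber a i⟩

variable {a}

theorem apply_firstInFiber (i : Fin n) : a (firstInFiber a i) = a i := by
  exact (Finset.mem_filter.1 ((fiber a i).min'_mem ⟨i, self_mem_fiber a i⟩)).2

theorem apply_lastInFiber (i : Fin n) : a (lastInFiber a i) = a i := by
  exact (Finset.mem_filter.1 ((fiber a i).max'_mem ⟨i, self_mem_fiber a i⟩)).2

theorem firstInFiber_le {i j : Fin n} (h : a j = a i) : firstInFiber a i ≤ j :=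
  Finset.min'_le _ _ (by simpa [fiber] using h)

theorem le_lastInFiber {i j : Fin n} (h : a j = a i) : j ≤ lastInFiber a i :=
  Finset.le_max' _ _ (by simpa [fiber] using h)

theorem firstInFiber_congr {i j : Fin n} (h : a i = a j) :
    firstInFiber a i = firstInFiber a j := by
  simp only [firstInFiber, fiber, h]

theorem lastInFiber_congr {i j : Fin n} (h : a i = a j) :
    lastInFiber a i = lastInFiber a j := by
  simp only [lastInFiber, fiber, h]

variable (a)

/-- Interchange the first and the last position in each fiber of `a`. -/
def fiberSwap (i : Fin n) : Fin n := Equiv.swap (firstInFiber a i) (lastInFiber a i) i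

variable {a}

theorem apply_fiberSwap (i : Fin n) : a (fiberSwap a i) = a i := by
  unfold fiberSwap
  rw [Equiv.swap_apply_def]
  split_ifs with h1 h2
  · exact apply_lastInFiber i
  · exact apply_firstInFiber i
  · rfl

theorem fiberSwap_fiberSwap (i : Fin n) : fiberSwap a (fiberSwap a i) = i := by
  have h := apply_fiberSwap (a := a) i
  conv_lhs => rw [fiberSwap]
  rw [firstInFiber_congr h, lastInFiber_congr h, fiberSwap, Equiv.swap_apply_self]

theorem fiberSwap_firstInFiber (i : Fin n) : fiberSwap a (firstInFiber a i) = lastInFiber a i := by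
  have h := apply_firstInFiber (a := a) i
  rw [fiberSwap, firstInFiber_congr h, lastInFiber_congr h, Equiv.swap_apply_left]

theorem fiberSwap_lastInFiber (i : Fin n) : fiberSwap a (lastInFiber a i) = firstInFiber a i := by
  rw [← fiberSwap_firstInFiber, fiberSwap_fiberSwap]

end fiberSwap

/-- Only the first occurrence of each value matters: nothing can precede it, and a plus there serves
every later minus. -/
theorem mem_plusBeforeCodes_iff {n : ℕ} {c : BuildTreeCode n} :
    c ∈ plusBeforeCodes n ↔ ∀ i, c.σ (firstInFiber c.a i) = 1 := by
  constructor
  · intro h i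
    rcases Int.units_eq_one_or (c.σ (firstInFiber c.a i)) with h1 | h1
    · exact h1
    · obtain ⟨j, hj, hja, -⟩ := h _ h1
      exact absurd (firstInFiber_le (hja.trans (apply_firstInFiber i))) (not_le.2 hj)
  · intro h i hi
    refine ⟨firstInFiber c.a i, lt_of_le_of_ne (firstInFiber_le rfl) fun he => ?_,
      apply_firstInFiber i, h i⟩
    have := h i
    rw [he, hi] at this
    exact absurd this (by decide)

theorem mem_plusAfterCodes_iff {n : ℕ} {c : BuildTreeCode n} :
    c ∈ plusAfterCodes n ↔ ∀ i, c.σ (lastInFiber c.a i) = 1 := by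
  constructor
  · intro h i
    rcases Int.units_eq_one_or (c.σ (lastInFiber c.a i)) with h1 | h1
    · exact h1
    · obtain ⟨j, hj, hja, -⟩ := h _ h1
      exact absurd (le_lastInFiber (hja.trans (apply_lastInFiber i))) (not_le.2 hj)
  · intro h i hi
    refine ⟨lastInFiber c.a i, lt_of_le_of_ne (le_lastInFiber rfl) fun he => ?_,
      apply_lastInFiber i, h i⟩
    have := h i
    rw [← he, hi] at this
    exact absurd this (by decide)

/-- Interchange the first and the last sign for each value of a code. -/
def BuildTreeCode.swapSigns {n : ℕ} (c : BuildTreeCode n) : BuildTreeCode n where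
  a := c.a
  σ := fun i => c.σ (fiberSwap c.a i)
  a_le := c.a_le
  ne_zero_neg i h := c.ne_zero_neg (fiberSwap c.a i) (by rw [apply_fiberSwap (a := c.a)]; exact h)

theorem BuildTreeCode.swapSigns_swapSigns {n : ℕ} (c : BuildTreeCode n) :
    c.swapSigns.swapSigns = c := by
  ext i
  · rfl
  · simp [swapSigns, fiberSwap_fiberSwap]

/-- The two conditions ask for a plus at the last, respectively the first, occurrence of each value,
so the involution `swapSigns` exchanges them. -/
theorem encard_plusAfterCodes (n : ℕ) : (plusAfterCodes n).encard = pathCount n 0 1 := by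
  rw [← encard_plusBeforeCodes]
  refine Set.encard_congr ⟨fun c => ⟨c.1.swapSigns, ?_⟩, fun c => ⟨c.1.swapSigns, ?_⟩,
    fun c => Subtype.ext c.1.swapSigns_swapSigns, fun c => Subtype.ext c.1.swapSigns_swapSigns⟩
  · rw [mem_plusBeforeCodes_iff]
    intro i
    simpa only [BuildTreeCode.swapSigns, fiberSwap_firstInFiber] using
      mem_plusAfterCodes_iff.1 c.2 i
  · rw [mem_plusAfterCodes_iff]
    intro i
    simpa only [BuildTreeCode.swapSigns, fiberSwap_lastInFiber] using
      mem_plusBeforeCodes_iff.1 c.2 i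

/-! ### Insertion of leaves into plane forests -/

namespace PlaneTree

variable {α : Type}

theorem forest_induction {P : List (PlaneTree α) → Prop} (nil : P [])
    (cons : ∀ a cs F, P cs → P F → P (node a cs :: F)) : ∀ F, P F
  | [] => nil
  | node a cs :: F => cons a cs F (forest_induction nil cons cs) (forest_induction nil cons F)

/-- The forests obtained by inserting a leaf with label `l`, but neither at the left end of the
forest nor immediately to the right of a leaf. -/
def innerInsertions (l : α) : List (PlaneTree α) → List (List (PlaneTree α))
  | [] => []
  | node a cs :: F =>
    ((node l [] :: cs) :: innerInsertions l cs).map (fun cs' => node a cs' :: F) ++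
      ((if cs.isEmpty then [] else [node l [] :: F]) ++ innerInsertions l F).map (node a cs :: ·)

/-- The forests obtained by inserting a leaf with label `l`, not immediately to the right of a
leaf. -/
def insertions (l : α) (F : List (PlaneTree α)) : List (List (PlaneTree α)) :=
  (node l [] :: F) :: innerInsertions l F

theorem mem_innerInsertions_cons {l a : α} {cs F G : List (PlaneTree α)} :
    G ∈ innerInsertions l (node a cs :: F) ↔
      (∃ cs' ∈ insertions l cs, G = node a cs' :: F) ∨
      (cs ≠ [] ∧ G = node a cs :: node l [] :: F) ∨
      ∃ F' ∈ innerInsertions l F, G = node a cs :: F' := by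
  rw [innerInsertions, List.mem_append, List.mem_map, List.mem_map, ← insertions]
  simp only [List.mem_append, eq_comm (a := G)]
  rcases cs with _ | ⟨c, cs⟩
  · simp
  · simp

theorem mem_insertions {l : α} {F G : List (PlaneTree α)} :
    G ∈ insertions l F ↔ G = node l [] :: F ∨ G ∈ innerInsertions l F := by
  rw [insertions, List.mem_cons]

theorem ne_nil_of_mem_insertions {l : α} {F G : List (PlaneTree α)} (h : G ∈ insertions l F) :
    G ≠ [] := by
  rcases mem_insertions.1 h with rfl | h
  · simp
  · rcases F with _ | ⟨⟨a, cs⟩, F⟩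
    · simp [innerInsertions] at h
    · rcases mem_innerInsertions_cons.1 h with ⟨_, _, rfl⟩ | ⟨_, rfl⟩ | ⟨_, _, rfl⟩ <;> simp

/-- The labels of a forest. -/
def forestLabels (F : List (PlaneTree α)) : List α := F.flatMap labels

@[simp]
theorem forestLabels_nil : forestLabels ([] : List (PlaneTree α)) = [] := rfl

@[simp]
theorem forestLabels_cons (a : α) (cs F : List (PlaneTree α)) :
    forestLabels (node a cs :: F) = a :: (forestLabels cs ++ forestLabels F) := by
  simp [forestLabels, labels]

theorem forestLabels_perm_of_mem_insertions {l : α} (F : List (PlaneTree α)) :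
    ∀ G ∈ insertions l F, (forestLabels G).Perm (l :: forestLabels F) := by
  induction F using forest_induction with
  | nil => simp [insertions, innerInsertions]
  | cons a cs F ihcs ihF =>
    intro G hG
    rcases mem_insertions.1 hG with rfl | hG
    · simp
    rcases mem_innerInsertions_cons.1 hG with ⟨cs', hcs', rfl⟩ | ⟨_, rfl⟩ | ⟨F', hF', rfl⟩
    · simp only [forestLabels_cons]
      exact (((ihcs cs' hcs').append_right _).cons a).trans (List.Perm.swap _ _ _)
    · simp only [forestLabels_cons, forestLabels_nil, List.nil_append]
      exact (List.perm_middle.cons a).trans (List.Perm.swap _ _ _)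
    · simp only [forestLabels_cons]
      have h := ihF F' (mem_insertions.2 (Or.inr hF'))
      exact (((h.append_left _).trans List.perm_middle).cons a).trans (List.Perm.swap _ _ _)

theorem ne_of_mem_insertions {l : α} {F G : List (PlaneTree α)} (h : G ∈ insertions l F) :
    G ≠ F := by
  rintro rfl
  have := (forestLabels_perm_of_mem_insertions _ _ h).length_eq
  simp at this

/-- Excluding the place to the right of a leaf is what prevents repetitions: a front insertion could
agree with a later one only if the first tree were itself a leaf labeled `l`, and then the tail
would have been obtained by both a front and an inner insertion. -/
theorem nodup_insertions (l : α) (F : List (PlaneTree α)) : (insertions l F).Nodup := by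
  induction F using forest_induction with
  | nil => simp [insertions, innerInsertions]
  | cons a cs F ihcs ihF =>
    have hF := List.nodup_cons.1 ihF
    refine List.nodup_cons.2 ⟨fun h => ?_, ?_⟩
    · rcases mem_innerInsertions_cons.1 h with ⟨cs', hcs', h⟩ | ⟨hcs, h⟩ | ⟨F', hF', h⟩
      · simp only [List.cons.injEq, node.injEq] at h
        exact ne_nil_of_mem_insertions hcs' h.1.2.symm
      · simp only [List.cons.injEq, node.injEq] at h
        exact hcs h.1.2.symm
      · simp only [List.cons.injEq, node.injEq] at h
        obtain ⟨⟨rfl, rfl⟩, rfl⟩ := h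
        exact hF.1 hF'
    · rw [innerInsertions, ← insertions]
      refine List.Nodup.append (ihcs.map fun x y h => by simpa using h) ?_ ?_
      · refine List.Nodup.map (fun x y h => by simpa using h) ?_
        split_ifs
        · exact hF.2
        · exact ihF
      · intro G hG hG'
        obtain ⟨cs', hcs', rfl⟩ := List.mem_map.1 hG
        obtain ⟨F', -, h⟩ := List.mem_map.1 hG'
        simp only [List.cons.injEq, node.injEq] at h
        exact ne_of_mem_insertions hcs' h.1.2.symm

/-- The number of leaves of a forest. -/
def leafCount : List (PlaneTree α) → ℕ
  | [] => 0
  | node _ cs :: F => (if cs.isEmpty then 1 else leafCount cs) + leafCount F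

/-- The number of ways of inserting a leaf which is neither at the left end nor immediately to the
right of a leaf, and which increases the number of leaves. -/
def slotCount : List (PlaneTree α) → ℕ
  | [] => 0
  | node _ cs :: F => (if cs.isEmpty then 0 else slotCount cs + 2) + slotCount F

theorem leafCount_cons_of_ne_nil {a : α} {cs F : List (PlaneTree α)} (h : cs ≠ []) :
    leafCount (node a cs :: F) = leafCount cs + leafCount F := by
  simp [leafCount, h]

theorem slotCount_cons_of_ne_nil {a : α} {cs F : List (PlaneTree α)} (h : cs ≠ []) :
    slotCount (node a cs :: F) = slotCount cs + 2 + slotCount F := by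
  simp [slotCount, h]

theorem leafCount_cons_leaf {a : α} {F : List (PlaneTree α)} :
    leafCount (node a [] :: F) = leafCount F + 1 := by
  simp [leafCount, add_comm]

theorem slotCount_cons_leaf {a : α} {F : List (PlaneTree α)} :
    slotCount (node a [] :: F) = slotCount F := by
  simp [slotCount]

/-- A leaf put below an old leaf keeps the number of leaves and creates two slots, to the left of
the new leaf and to the right of its parent. Any other insertion adds a leaf; it splits one slot
into two places, of which the one to the right of the new leaf is forbidden. The test function is
arbitrary so that the contribution of the rest of the forest can be absorbed into it. -/
theorem sum_innerInsertions (l : α) (F : List (PlaneTree α)) (g : ℕ → ℕ → ℕ) :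
    ((innerInsertions l F).map fun G => g (leafCount G) (slotCount G)).sum =
      leafCount F * g (leafCount F) (slotCount F + 2) +
        slotCount F * g (leafCount F + 1) (slotCount F) := by
  induction F using forest_induction generalizing g with
  | nil => simp [innerInsertions, leafCount, slotCount]
  | cons a cs F ihcs ihF =>
    rw [innerInsertions, ← insertions]
    simp only [List.map_append, List.sum_append, List.map_map]
    rcases eq_or_ne cs [] with rfl | hne
    · simp only [insertions, innerInsertions, List.isEmpty_nil, if_true, List.map_nil,
        List.sum_nil, List.map_cons, List.sum_cons, Function.comp_def, leafCount_cons_leaf,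
        slotCount_cons_leaf]
      have h := ihF fun x y => g (x + 1) y
      rw [h, leafCount_cons_of_ne_nil (by simp), slotCount_cons_of_ne_nil (by simp),
        leafCount_cons_leaf, slotCount_cons_leaf]
      simp only [leafCount, slotCount, zero_add, add_comm 1, add_comm 2]
      ring
    · have e1 : ∀ G ∈ insertions l cs,
          ((fun G => g (leafCount G) (slotCount G)) ∘ fun cs' => node a cs' :: F) G =
            g (leafCount G + leafCount F) (slotCount G + 2 + slotCount F) := by
        intro G hG
        simp only [Function.comp, leafCount_cons_of_ne_nil (ne_nil_of_mem_insertions hG),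
          slotCount_cons_of_ne_nil (ne_nil_of_mem_insertions hG)]
      rw [List.map_congr_left e1]
      have h1 := ihcs fun x y => g (x + leafCount F) (y + 2 + slotCount F)
      have h2 := ihF fun x y => g (leafCount cs + x) (slotCount cs + 2 + y)
      simp only [insertions, List.map_cons, List.sum_cons, List.isEmpty_iff, hne, if_false,
        List.map_nil, List.sum_nil, Function.comp_def, leafCount_cons_of_ne_nil hne,
        slotCount_cons_of_ne_nil hne, leafCount_cons_leaf, slotCount_cons_leaf, h1, h2]
      simp only [add_assoc, add_comm, add_left_comm]
      ring

theorem sum_insertions (l : α) (F : List (PlaneTree α)) (g : ℕ → ℕ → ℕ) :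
    ((insertions l F).map fun G => g (leafCount G) (slotCount G + 1)).sum =
      leafCount F * g (leafCount F) (slotCount F + 1 + 2) +
        (slotCount F + 1) * g (leafCount F + 1) (slotCount F + 1) := by
  rw [insertions, List.map_cons, List.sum_cons, sum_innerInsertions l F fun x y => g x (y + 1),
    leafCount_cons_leaf, slotCount_cons_leaf]
  ring_nf

/-! ### Drawings -/

theorem RemoveLeaf.cons {a b : α} {F F' : List (PlaneTree α)} (c : PlaneTree α)
    (h : RemoveLeaf (node a F') (node b F)) : RemoveLeaf (node a (c :: F')) (node a (c :: F)) := by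
  generalize hT : node a F' = T at h
  generalize hT' : node b F = T' at h
  cases h with
  | here a b L R =>
    obtain ⟨rfl, rfl⟩ := node.inj hT
    obtain ⟨rfl, rfl⟩ := node.inj hT'
    exact RemoveLeaf.here _ _ (c :: L) R
  | there a L R t t' h =>
    obtain ⟨rfl, rfl⟩ := node.inj hT
    obtain ⟨rfl, rfl⟩ := node.inj hT'
    exact RemoveLeaf.there _ (c :: L) R t t' h

theorem removeLeaf_of_mem_insertions {l : α} (F : List (PlaneTree α)) :
    ∀ G ∈ insertions l F, ∀ a, RemoveLeaf (node a G) (node a F) := by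
  induction F using forest_induction with
  | nil =>
    intro G hG a
    simp only [insertions, innerInsertions, List.mem_singleton] at hG
    subst hG
    exact RemoveLeaf.here a l [] []
  | cons b cs F ihcs ihF =>
    intro G hG a
    rcases mem_insertions.1 hG with rfl | hG
    · exact RemoveLeaf.here a l [] _
    rcases mem_innerInsertions_cons.1 hG with ⟨cs', hcs', rfl⟩ | ⟨_, rfl⟩ | ⟨F', hF', rfl⟩
    · exact RemoveLeaf.there a [] F _ _ (ihcs cs' hcs' b)
    · exact RemoveLeaf.here a l [_] F
    · exact (ihF F' (mem_insertions.2 (Or.inr hF')) a).cons _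

/-- A leaf to the right of an unlabeled leaf can be exchanged with it without changing the forest;
repeated exchange moves the insertion to an allowed place. -/
theorem leaf_mem_insertions (L R : List (PlaneTree Unit)) :
    L ++ node () [] :: R ∈ insertions () (L ++ R) := by
  induction L with
  | nil => exact mem_insertions.2 (Or.inl rfl)
  | cons c L ih =>
    obtain ⟨⟨⟩, cs⟩ := c
    simp only [List.cons_append]
    rcases mem_insertions.1 ih with h | h
    · rw [h]
      rcases eq_or_ne cs [] with rfl | hne
      · exact mem_insertions.2 (Or.inl rfl)
      · exact mem_insertions.2 (Or.inr (mem_innerInsertions_cons.2 (Or.inr (Or.inl ⟨hne, rfl⟩))))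
    · exact mem_insertions.2 (Or.inr (mem_innerInsertions_cons.2 (Or.inr (Or.inr ⟨_, h, rfl⟩))))

theorem append_mem_innerInsertions {l a : α} {cs cs' : List (PlaneTree α)}
    (h : cs' ∈ insertions l cs) (L R : List (PlaneTree α)) :
    L ++ node a cs' :: R ∈ innerInsertions l (L ++ node a cs :: R) := by
  induction L with
  | nil => exact mem_innerInsertions_cons.2 (Or.inl ⟨cs', h, rfl⟩)
  | cons c L ih =>
    obtain ⟨b, ds⟩ := c
    exact mem_innerInsertions_cons.2 (Or.inr (Or.inr ⟨_, ih, rfl⟩))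

theorem removeLeaf_iff_mem_insertions {T T' : PlaneTree Unit} :
    RemoveLeaf T' T ↔ T'.children ∈ insertions () T.children := by
  constructor
  · intro h
    induction h with
    | here a b L R => exact leaf_mem_insertions L R
    | there a L R t t' h ih =>
      obtain ⟨⟨⟩, cs⟩ := t
      obtain ⟨⟨⟩, cs'⟩ := t'
      exact mem_insertions.2 (Or.inr (append_mem_innerInsertions ih L R))
  · obtain ⟨⟨⟩, cs⟩ := T
    obtain ⟨⟨⟩, cs'⟩ := T'
    exact fun h => removeLeaf_of_mem_insertions _ _ h ()

end PlaneTree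

open PlaneTree in
theorem encard_drawings (n : ℕ) : (drawings n).encard = pathCount n 0 1 := by
  classical
  let snocTree (n : ℕ) (x : Fin (n + 1) → PlaneTree Unit) (G : List (PlaneTree Unit)) :
    Fin (n + 2) → PlaneTree Unit := Fin.snoc (α := fun _ => PlaneTree Unit) x (node () G)
  have hlast : ∀ n x G, snocTree n x G (Fin.last _) = node () G := by simp [snocTree]
  have hinj : ∀ n x, Function.Injective (snocTree n x) := by
    intro n x G G' h
    have := congrFun h (Fin.last _)
    rw [hlast, hlast] at this
    exact (node.inj this).2
  refine encard_eq_pathCount drawings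
    (fun n x => (insertions () (x (Fin.last n)).children).toFinset.image (snocTree n x))
    (fun n x => (leafCount (x (Fin.last n)).children, slotCount (x (Fin.last n)).children + 1))
    (fun _ => node () []) ?_ ?_ ?_ ?_ ?_ n
  · ext T
    simp only [Set.mem_singleton_iff]
    constructor
    · intro h
      funext i
      rw [show i = 0 from Fin.fin_one_eq_zero i, h.1]
    · rintro rfl
      exact ⟨rfl, fun i => i.elim0⟩
  · simp [children, leafCount, slotCount]
  · intro n y
    simp only [Finset.mem_image, List.mem_toFinset]
    constructor
    · intro hy
      refine ⟨Fin.init y, ⟨hy.1, fun i => hy.2 i.castSucc⟩, (y (Fin.last _)).children,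
        removeLeaf_iff_mem_insertions.1 (hy.2 (Fin.last n)), ?_⟩
      have : node () (y (Fin.last _)).children = y (Fin.last _) := by
        obtain ⟨⟨⟩, cs⟩ := y (Fin.last _)
        rfl
      simp only [snocTree, this]
      exact Fin.snoc_init_self y
    · rintro ⟨x, hx, G, hG, rfl⟩
      refine ⟨?_, fun i => ?_⟩
      · have : snocTree n x G 0 = x 0 := Fin.snoc_castSucc (α := fun _ => PlaneTree Unit) _ _ 0
        rw [this, hx.1]
      · induction i using Fin.lastCases with
        | last =>
          rw [Fin.succ_last, hlast]
          refine removeLeaf_iff_mem_insertions.2 ?_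
          simpa [snocTree, children] using hG
        | cast i =>
          have hcast : ∀ j : Fin (n + 1), snocTree n x G j.castSucc = x j :=
            fun j => Fin.snoc_castSucc (α := fun _ => PlaneTree Unit) _ _ j
          rw [Fin.succ_castSucc, hcast, hcast]
          exact hx.2 i
  · intro n x _ x' _ y hy hy'
    obtain ⟨G, -, rfl⟩ := Finset.mem_image.1 hy
    obtain ⟨G', -, h⟩ := Finset.mem_image.1 hy'
    have := congrArg (Fin.init (α := fun _ => PlaneTree Unit)) h
    simpa [snocTree] using this.symm
  · intro n x _ g
    rw [Finset.sum_image fun G _ G' _ h => hinj n x h, List.sum_toFinset _ (nodup_insertions _ _)]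
    simp only [hlast, children]
    exact sum_insertions () _ g

/-! ### Klazar trees -/

namespace PlaneTree

/-- All labels in the forest are larger than those of their parents, and those of the roots are
larger than `p`. -/
def ForestIncreasing (p : ℕ) : List (PlaneTree ℕ) → Prop
  | [] => True
  | node a cs :: F => p < a ∧ ForestIncreasing a cs ∧ ForestIncreasing p F

/-- For the siblings `v` in the list, and every sibling `u` in the maximal interval of siblings
with larger labels immediately to the right of `v`, there is a child of `v` with a smaller label
than `u`. -/
def SiblingCondition : List (PlaneTree ℕ) → Prop
  | [] => True
  | c :: F => (∀ u ∈ (F.map label).takeWhile (c.label < ·), ∃ d ∈ c.children, d.label < u) ∧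
      SiblingCondition F

/-- The sibling condition at all levels of a forest. -/
def ForestKlazar : List (PlaneTree ℕ) → Prop
  | [] => True
  | node a cs :: F => (∀ u ∈ (F.map label).takeWhile (a < ·), ∃ d ∈ cs, d.label < u) ∧
      ForestKlazar cs ∧ ForestKlazar F

@[simp]
theorem forestIncreasing_nil {p : ℕ} : ForestIncreasing p [] := by simp [ForestIncreasing]

theorem forestIncreasing_cons {p a : ℕ} {cs F : List (PlaneTree ℕ)} :
    ForestIncreasing p (node a cs :: F) ↔ p < a ∧ ForestIncreasing a cs ∧ ForestIncreasing p F := by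
  rw [ForestIncreasing]

@[simp]
theorem forestKlazar_nil : ForestKlazar [] := by simp [ForestKlazar]

theorem forestKlazar_cons {a : ℕ} {cs F : List (PlaneTree ℕ)} :
    ForestKlazar (node a cs :: F) ↔
      (∀ u ∈ (F.map label).takeWhile (a < ·), ∃ d ∈ cs, d.label < u) ∧
        ForestKlazar cs ∧ ForestKlazar F := by
  rw [ForestKlazar]

theorem forall_isSubtree_iff {α : Type} {P : PlaneTree α → Prop} {t : PlaneTree α} :
    (∀ s, IsSubtree s t → P s) ↔ P t ∧ ∀ c ∈ t.children, ∀ s, IsSubtree s c → P s := by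
  constructor
  · exact fun h => ⟨h t (.refl t), fun c hc s hs => h s (.child hc hs)⟩
  · rintro ⟨h1, h2⟩ s hs
    cases hs with
    | refl => exact h1
    | child hc hs => exact h2 _ hc s hs

theorem forestIncreasing_iff (F : List (PlaneTree ℕ)) (p : ℕ) :
    ForestIncreasing p F ↔ (∀ c ∈ F, p < c.label) ∧
      ∀ c ∈ F, ∀ s, IsSubtree s c → ∀ d ∈ s.children, s.label < d.label := by
  induction F using forest_induction generalizing p with
  | nil => simp
  | cons a cs F ihcs ihF =>
    rw [ForestIncreasing, ihcs, ihF, List.forall_mem_cons, List.forall_mem_cons,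
      forall_isSubtree_iff (t := node a cs)]
    simp only [label, children]
    tauto

theorem forestKlazar_iff (F : List (PlaneTree ℕ)) :
    ForestKlazar F ↔ SiblingCondition F ∧
      ∀ c ∈ F, ∀ s, IsSubtree s c → SiblingCondition s.children := by
  induction F using forest_induction with
  | nil => simp [SiblingCondition]
  | cons a cs F ihcs ihF =>
    rw [ForestKlazar, ihcs, ihF, List.forall_mem_cons, SiblingCondition,
      forall_isSubtree_iff (t := node a cs)]
    simp only [label, children]
    tauto

theorem mem_takeWhile_iff {α : Type*} {p : α → Bool} {l : List α} {u : α} :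
    u ∈ l.takeWhile p ↔ ∃ (j : Fin l.length), l[j] = u ∧ ∀ k ≤ j, p l[k] := by
  induction l with
  | nil => simp
  | cons a l ih =>
    rw [List.takeWhile_cons]
    constructor
    · intro h
      split_ifs at h with ha
      · rcases List.mem_cons.1 h with rfl | h
        · refine ⟨⟨0, by simp⟩, rfl, fun k hk => ?_⟩
          have : k = ⟨0, by simp⟩ := Fin.ext (Nat.le_zero.1 hk)
          rw [this]
          exact ha
        · obtain ⟨j, hj, hk⟩ := ih.1 h
          refine ⟨j.succ, hj, fun k => ?_⟩
          refine Fin.cases (fun _ => ha) (fun k hkj => ?_) k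
          exact hk k (Fin.succ_le_succ_iff.1 hkj)
      · simp at h
    · rintro ⟨j, hj, hk⟩
      have ha : p a := hk ⟨0, by simp⟩ (Nat.zero_le _)
      rw [if_pos ha]
      revert hj hk
      refine Fin.cases (fun hj _ => ?_) (fun j hj hk => ?_) j
      · exact List.mem_cons.2 (Or.inl hj.symm)
      · exact List.mem_cons.2 (Or.inr (ih.2 ⟨j, hj, fun k hkj =>
          hk k.succ (Fin.succ_le_succ_iff.2 hkj)⟩))

theorem siblingCondition_iff_forall (cs : List (PlaneTree ℕ)) :
    SiblingCondition cs ↔ ∀ i j : Fin cs.length, i < j →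
      (∀ k, i < k → k ≤ j → cs[i].label < cs[k].label) →
        ∃ d ∈ cs[i].children, d.label < cs[j].label := by
  induction cs with
  | nil => simp [SiblingCondition]
  | cons c F ih =>
    rw [SiblingCondition, ih]
    constructor
    · rintro ⟨h1, h2⟩ i
      refine Fin.cases (fun j => ?_) (fun i j => ?_) i
      · refine Fin.cases (fun h => absurd h (lt_irrefl _)) (fun j _ hk => ?_) j
        refine h1 F[j].label (mem_takeWhile_iff.2 ⟨⟨j, by simp⟩, by simp, fun k hkj => ?_⟩)
        have := hk ⟨k + 1, by simpa using k.2⟩ (Nat.succ_pos _) (Nat.succ_le_succ hkj)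
        simpa using this
      · refine Fin.cases (fun h => absurd h (Fin.not_lt_zero _)) (fun j hij hk => ?_) j
        exact h2 i j (Fin.succ_lt_succ_iff.1 hij) fun k h1 h2 =>
          hk k.succ (Fin.succ_lt_succ_iff.2 h1) (Fin.succ_le_succ_iff.2 h2)
    · intro h
      refine ⟨fun u hu => ?_, fun i j hij hk => ?_⟩
      · obtain ⟨j, rfl, hj⟩ := mem_takeWhile_iff.1 hu
        have hjl : (j : ℕ) < F.length := by simpa using j.2
        have := h ⟨0, by simp⟩ ⟨j + 1, by simpa using hjl⟩ (Nat.succ_pos _) fun k => by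
          refine Fin.cases (fun h => absurd h (lt_irrefl _)) (fun k _ hkj => ?_) k
          have := hj ⟨k, by simp⟩ (Nat.le_of_succ_le_succ hkj)
          simpa using this
        simpa using this
      · exact h i.succ j.succ (Fin.succ_lt_succ_iff.2 hij) fun k => by
          refine Fin.cases (fun h => absurd h (Fin.not_lt_zero _)) (fun k h1 h2 => ?_) k
          exact hk k (Fin.succ_lt_succ_iff.1 h1) (Fin.succ_le_succ_iff.1 h2)

/-- The right associate is the leftmost sibling of minimal label in the run of larger siblings
immediately after `v`. A child smaller than it is smaller than everything in the run. -/
theorem siblingCondition_iff (cs : List (PlaneTree ℕ)) :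
    SiblingCondition cs ↔ ∀ i j : Fin cs.length, IsRightAssociate cs i j →
      cs[i].children ≠ [] ∧
        ∀ m, IsLeast {x | ∃ d ∈ cs[i].children, d.label = x} m → m < cs[j].label := by
  rw [siblingCondition_iff_forall]
  constructor
  · rintro h i j ⟨⟨hij, hlt, hbetween⟩, -⟩
    obtain ⟨d, hd, hdj⟩ := h i j hij fun k h1 h2 => by
      rcases h2.lt_or_eq with h2 | rfl
      · exact hlt.trans (hbetween k h1 h2)
      · exact hlt
    exact ⟨List.ne_nil_of_mem hd, fun m hm => (hm.2 ⟨d, hd, rfl⟩).trans_lt hdj⟩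
  · intro h i j hij hrun
    let run : Finset (Fin cs.length) :=
      Finset.univ.filter fun k => i < k ∧ ∀ k', i < k' → k' ≤ k → cs[i].label < cs[k'].label
    have hmem : ∀ k, k ∈ run ↔ i < k ∧ ∀ k', i < k' → k' ≤ k → cs[i].label < cs[k'].label := by
      simp [run]
    have hj : j ∈ run := (hmem j).2 ⟨hij, hrun⟩
    obtain ⟨k₁, hk₁, hmin⟩ := run.exists_min_image (fun k => cs[k].label) ⟨j, hj⟩
    -- Labels are not assumed distinct here; the leftmost minimizer ensures the strict inequality
    -- with the siblings in between.
    let minima := run.filter fun k => cs[k].label = cs[k₁].label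
    have hne : minima.Nonempty := ⟨k₁, by simp [minima, hk₁]⟩
    let k₀ := minima.min' hne
    obtain ⟨hk₀, hk₀₁⟩ := Finset.mem_filter.1 (minima.min'_mem hne)
    change k₀ ∈ run at hk₀
    change cs[k₀].label = cs[k₁].label at hk₀₁
    obtain ⟨hik₀, hk₀run⟩ := (hmem k₀).1 hk₀
    have hassoc : IsRightAssociate cs i k₀ := by
      refine ⟨⟨hik₀, hk₀run k₀ hik₀ le_rfl, fun k hik hk => ?_⟩, fun j' hj' => ?_⟩
      · have hkrun : k ∈ run := (hmem k).2 ⟨hik, fun k' h1 h2 => hk₀run k' h1 (h2.trans hk.le)⟩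
        refine lt_of_le_of_ne (hk₀₁.trans_le (hmin k hkrun)) fun he => ?_
        have : k ∈ minima := Finset.mem_filter.2 ⟨hkrun, he.symm.trans hk₀₁⟩
        exact absurd (minima.min'_le k this) (not_le.2 hk)
      · rw [hk₀₁]
        refine hmin j' ((hmem j').2 ⟨hj'.1, fun k' h1 h2 => ?_⟩)
        rcases h2.lt_or_eq with h2 | rfl
        · exact hj'.2.1.trans (hj'.2.2 k' h1 h2)
        · exact hj'.2.1
    obtain ⟨hch, hlt⟩ := h i k₀ hassoc
    obtain ⟨d, hd, hdmin⟩ := (cs[i].children.map label).toFinset.exists_min_image id (by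
      obtain ⟨d, hd⟩ := List.exists_mem_of_ne_nil _ hch
      exact ⟨d.label, by simpa using ⟨d, hd, rfl⟩⟩)
    have hleast : IsLeast {x | ∃ d ∈ cs[i].children, d.label = x} d := by
      refine ⟨by simpa using hd, ?_⟩
      rintro x ⟨d', hd', rfl⟩
      exact hdmin d'.label (by simpa using ⟨d', hd', rfl⟩)
    obtain ⟨d', hd', rfl⟩ := hleast.1
    exact ⟨d', hd', (hlt _ hleast).trans_le (hk₀₁.trans_le (hmin j hj))⟩

theorem isKlazar_node_iff {n a : ℕ} {cs : List (PlaneTree ℕ)} :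
    IsKlazar n (node a cs) ↔ (a :: forestLabels cs).Perm (List.range (n + 1)) ∧
      ForestIncreasing a cs ∧ ForestKlazar cs := by
  rw [IsKlazar, IsIncreasinglyLabeled, forall_isSubtree_iff, forall_isSubtree_iff,
    forestIncreasing_iff, forestKlazar_iff]
  simp_rw [← siblingCondition_iff]
  simp only [children, label, labels, forestLabels, and_assoc]

/-! ### Insertion and removal of the largest label -/

/-- Remove all subtrees whose root has label `l`. -/
def prune (l : ℕ) : List (PlaneTree ℕ) → List (PlaneTree ℕ)
  | [] => []
  | node a cs :: F => if a = l then prune l F else node a (prune l cs) :: prune l F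

theorem prune_eq_self {l : ℕ} (F : List (PlaneTree ℕ)) (h : l ∉ forestLabels F) :
    prune l F = F := by
  induction F using forest_induction with
  | nil => simp [prune]
  | cons a cs F ihcs ihF =>
    simp only [forestLabels_cons, List.mem_cons, List.mem_append, not_or] at h
    rw [prune, if_neg (Ne.symm h.1), ihcs h.2.1, ihF h.2.2]

/-- Pruning undoes insertion of a fresh label, which gives uniqueness of the parent in the
generating tree. -/
theorem prune_of_mem_insertions {l : ℕ} (F : List (PlaneTree ℕ)) (h : l ∉ forestLabels F) :
    ∀ G ∈ insertions l F, prune l G = F := by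
  induction F using forest_induction with
  | nil => simp [insertions, innerInsertions, prune]
  | cons a cs F ihcs ihF =>
    have hself := prune_eq_self _ h
    simp only [forestLabels_cons, List.mem_cons, List.mem_append, not_or] at h
    intro G hG
    rcases mem_insertions.1 hG with rfl | hG
    · rw [prune, if_pos rfl, hself]
    rcases mem_innerInsertions_cons.1 hG with ⟨cs', hcs', rfl⟩ | ⟨_, rfl⟩ | ⟨F', hF', rfl⟩
    · rw [prune, if_neg (Ne.symm h.1), ihcs h.2.1 cs' hcs', prune_eq_self F h.2.2]
    · rw [prune, if_neg (Ne.symm h.1), prune, if_pos rfl, prune_eq_self F h.2.2,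
        prune_eq_self cs h.2.1]
    · rw [prune, if_neg (Ne.symm h.1), prune_eq_self cs h.2.1,
        ihF h.2.2 F' (mem_insertions.2 (Or.inr hF'))]

theorem map_label_prune (l : ℕ) (F : List (PlaneTree ℕ)) :
    (prune l F).map label = (F.map label).filter (· ≠ l) := by
  induction F using forest_induction with
  | nil => simp [prune]
  | cons a cs F ihcs ihF =>
    rw [prune]
    split_ifs with h
    · simp [ihF, label, h]
    · simp [ihF, label, h]

/-- Entries dropped by the filter satisfy `p`, so restoring them cannot end the initial run earlier.
-/
theorem mem_takeWhile_of_filter {p : ℕ → Bool} {q : ℕ → Bool} (hpq : ∀ x, ¬ q x → p x)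
    {l : List ℕ} {u : ℕ} (hu : u ∈ (l.filter q).takeWhile p) : u ∈ l.takeWhile p := by
  induction l with
  | nil => simp at hu
  | cons a l ih =>
    by_cases hq : q a
    · rw [List.filter_cons_of_pos hq, List.takeWhile_cons] at hu
      split_ifs at hu with hp
      · rw [List.takeWhile_cons, if_pos hp]
        rcases List.mem_cons.1 hu with rfl | hu
        · exact List.mem_cons_self
        · exact List.mem_cons_of_mem _ (ih hu)
      · simp at hu
    · rw [List.filter_cons_of_neg hq] at hu
      rw [List.takeWhile_cons, if_pos (hpq a hq)]
      exact List.mem_cons_of_mem _ (ih hu)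

theorem mem_takeWhile_filter {p : ℕ → Bool} {q : ℕ → Bool} {l : List ℕ} {u : ℕ}
    (hu : u ∈ l.takeWhile p) (hq : q u) : u ∈ (l.filter q).takeWhile p := by
  induction l with
  | nil => simp at hu
  | cons a l ih =>
    rw [List.takeWhile_cons] at hu
    split_ifs at hu with hp
    · by_cases hqa : q a
      · rw [List.filter_cons_of_pos hqa, List.takeWhile_cons, if_pos hp]
        rcases List.mem_cons.1 hu with rfl | hu
        · exact List.mem_cons_self
        · exact List.mem_cons_of_mem _ (ih hu)
      · rw [List.filter_cons_of_neg hqa]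
        rcases List.mem_cons.1 hu with rfl | hu
        · exact absurd hq hqa
        · exact ih hu
    · simp at hu

theorem label_mem_forestLabels {α : Type} {F : List (PlaneTree α)} {c : PlaneTree α}
    (h : c ∈ F) : c.label ∈ forestLabels F := by
  refine List.mem_flatMap.2 ⟨c, h, ?_⟩
  obtain ⟨a, cs⟩ := c
  simp [labels, label]

theorem map_label_filter_of_mem_insertions {l : ℕ} {F G : List (PlaneTree ℕ)}
    (h : l ∉ forestLabels F) (hG : G ∈ insertions l F) :
    F.map label = (G.map label).filter (· ≠ l) := by
  rw [← map_label_prune, prune_of_mem_insertions F h G hG]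

theorem forestIncreasing_of_mem_insertions {l p : ℕ} (F : List (PlaneTree ℕ)) (hp : p < l)
    (hl : ∀ x ∈ forestLabels F, x < l) (hF : ForestIncreasing p F) :
    ∀ G ∈ insertions l F, ForestIncreasing p G := by
  induction F using forest_induction generalizing p with
  | nil => simpa [insertions, innerInsertions, ForestIncreasing] using hp
  | cons a cs F ihcs ihF =>
    have hF' := hF
    obtain ⟨ha, hcs, hF⟩ := forestIncreasing_cons.1 hF
    simp only [forestLabels_cons, List.mem_cons, List.mem_append] at hl
    intro G hG
    rcases mem_insertions.1 hG with rfl | hG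
    · exact forestIncreasing_cons.2 ⟨hp, forestIncreasing_nil, hF'⟩
    rcases mem_innerInsertions_cons.1 hG with ⟨cs', hcs', rfl⟩ | ⟨_, rfl⟩ | ⟨G', hG', rfl⟩
    · exact forestIncreasing_cons.2 ⟨ha,
        ihcs (hl a (Or.inl rfl)) (fun x hx => hl x (Or.inr (Or.inl hx))) hcs cs' hcs', hF⟩
    · exact forestIncreasing_cons.2 ⟨ha, hcs,
        forestIncreasing_cons.2 ⟨hp, forestIncreasing_nil, hF⟩⟩
    · exact forestIncreasing_cons.2 ⟨ha, hcs, ihF hp (fun x hx => hl x (Or.inr (Or.inr hx))) hF G'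
        (mem_insertions.2 (Or.inr hG'))⟩

theorem takeWhile_eq_nil_of_forall_lt {l : ℕ} {F : List (PlaneTree ℕ)}
    (hl : ∀ x ∈ forestLabels F, x < l) : (F.map label).takeWhile (l < ·) = [] := by
  rcases F with _ | ⟨c, F⟩
  · rfl
  · have := hl _ (label_mem_forestLabels List.mem_cons_self)
    simp [this.le]

/-- The new leaf has the largest label, so its own run is empty. It can only create a requirement
for siblings to its left, and it destroys no witness among the children. -/
theorem forestKlazar_of_mem_insertions {l : ℕ} (F : List (PlaneTree ℕ))
    (hl : ∀ x ∈ forestLabels F, x < l) (hF : ForestKlazar F) :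
    ∀ G ∈ insertions l F, ForestKlazar G := by
  induction F using forest_induction with
  | nil => simp [insertions, innerInsertions, ForestKlazar]
  | cons a cs F ihcs ihF =>
    have hF' := hF
    obtain ⟨hhead, hcs, hF⟩ := forestKlazar_cons.1 hF
    have hl' := hl
    simp only [forestLabels_cons, List.mem_cons, List.mem_append] at hl
    have hlcs : ∀ x ∈ forestLabels cs, x < l := fun x hx => hl x (Or.inr (Or.inl hx))
    have hlF : ∀ x ∈ forestLabels F, x < l := fun x hx => hl x (Or.inr (Or.inr hx))
    intro G hG
    rcases mem_insertions.1 hG with rfl | hG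
    · refine forestKlazar_cons.2 ⟨fun u hu => ?_, forestKlazar_nil, hF'⟩
      rw [takeWhile_eq_nil_of_forall_lt hl'] at hu
      simp at hu
    rcases mem_innerInsertions_cons.1 hG with ⟨cs', hcs', rfl⟩ | ⟨hne, rfl⟩ | ⟨G', hG', rfl⟩
    · refine forestKlazar_cons.2 ⟨fun u hu => ?_, ihcs hlcs hcs cs' hcs', hF⟩
      obtain ⟨d, hd, hdu⟩ := hhead u hu
      have h := List.mem_map_of_mem (f := label) hd
      rw [map_label_filter_of_mem_insertions (fun h => (hlcs _ h).false) hcs'] at h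
      obtain ⟨d', hd', he⟩ := List.mem_map.1 (List.mem_filter.1 h).1
      exact ⟨d', hd', he ▸ hdu⟩
    · refine forestKlazar_cons.2 ⟨fun u hu => ?_, hcs,
        forestKlazar_cons.2 ⟨fun u hu => ?_, forestKlazar_nil, hF⟩⟩
      · rw [List.map_cons, List.takeWhile_cons] at hu
        split_ifs at hu
        · rcases List.mem_cons.1 hu with rfl | hu
          · obtain ⟨d, hd⟩ := List.exists_mem_of_ne_nil _ hne
            exact ⟨d, hd, hlcs _ (label_mem_forestLabels hd)⟩
          · exact hhead u hu
        · simp at hu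
      · rw [takeWhile_eq_nil_of_forall_lt hlF] at hu
        simp at hu
    · have hG'' := mem_insertions.2 (Or.inr hG')
      refine forestKlazar_cons.2 ⟨fun u hu => ?_, hcs, ihF hlF hF G' hG''⟩
      have hmap := map_label_filter_of_mem_insertions (fun h => (hlF _ h).false) hG''
      -- If the new leaf is in the run of `a` but not first in it, the first sibling `b` of the run
      -- already supplies a child smaller than b, hence smaller than `l`.
      by_cases hul : u = l
      · subst hul
        rcases F with _ | ⟨⟨b, ds⟩, F⟩
        · simp [innerInsertions] at hG'
        obtain ⟨ds', G₁, rfl⟩ : ∃ ds' G₁, G' = node b ds' :: G₁ := by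
          rcases mem_innerInsertions_cons.1 hG' with ⟨cs', _, rfl⟩ | ⟨_, rfl⟩ | ⟨_, _, rfl⟩ <;>
          exact ⟨_, _, rfl⟩
        have hab : a < b := by
          by_contra hab
          simp [label, hab] at hu
        obtain ⟨d, hd, hdb⟩ := hhead b (by simp [label, hab])
        exact ⟨d, hd, hdb.trans (hlF b (by simp))⟩
      · refine hhead u ?_
        rw [hmap]
        exact mem_takeWhile_filter hu (by simpa using hul)

theorem forestIncreasing_prune {l p : ℕ} (F : List (PlaneTree ℕ)) (hF : ForestIncreasing p F) :
    ForestIncreasing p (prune l F) := by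
  induction F using forest_induction generalizing p with
  | nil => simp [prune]
  | cons a cs F ihcs ihF =>
    rw [forestIncreasing_cons] at hF
    rw [prune]
    split_ifs
    · exact ihF hF.2.2
    · exact forestIncreasing_cons.2 ⟨hF.1, ihcs hF.2.1, ihF hF.2.2⟩

theorem ForestIncreasing.lt_of_mem {p x : ℕ} (F : List (PlaneTree ℕ)) (hF : ForestIncreasing p F)
    (hx : x ∈ forestLabels F) : p < x := by
  induction F using forest_induction generalizing p with
  | nil => simp at hx
  | cons a cs F ihcs ihF =>
    rw [forestIncreasing_cons] at hF
    simp only [forestLabels_cons, List.mem_cons, List.mem_append] at hx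
    rcases hx with rfl | hx | hx
    · exact hF.1
    · exact hF.1.trans (ihcs hF.2.1 hx)
    · exact ihF hF.2.2 hx

/-- The largest label sits on a leaf because labels increase downward. A witness is smaller than
some label that is at most `l`, so removing `l` never removes a witness. -/
theorem mem_insertions_prune {l p : ℕ} (F : List (PlaneTree ℕ)) (hl : ∀ x ∈ forestLabels F, x ≤ l)
    (hmem : l ∈ forestLabels F) (hnd : (forestLabels F).Nodup) (hinc : ForestIncreasing p F)
    (hF : ForestKlazar F) : F ∈ insertions l (prune l F) ∧ ForestKlazar (prune l F) := by
  induction F using forest_induction generalizing p with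
  | nil => simp at hmem
  | cons a cs F ihcs ihF =>
    obtain ⟨hhead, hkcs, hkF⟩ := forestKlazar_cons.1 hF
    rw [forestIncreasing_cons] at hinc
    simp only [forestLabels_cons, List.mem_cons, List.mem_append] at hl hmem
    simp only [forestLabels_cons, List.nodup_cons, List.mem_append, not_or,
      List.nodup_append'] at hnd
    obtain ⟨⟨hacs, haF⟩, hndcs, hndF, hdisj⟩ := hnd
    have hlcs : ∀ x ∈ forestLabels cs, x ≤ l := fun x hx => hl x (Or.inr (Or.inl hx))
    have hlF : ∀ x ∈ forestLabels F, x ≤ l := fun x hx => hl x (Or.inr (Or.inr hx))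
    rcases eq_or_ne a l with rfl | hal
    · have hcs : cs = [] := by
        rcases cs with _ | ⟨c, cs⟩
        · rfl
        · have h := label_mem_forestLabels (List.mem_cons_self (a := c) (l := cs))
          exact absurd (hlcs _ h) (not_le.2 (ForestIncreasing.lt_of_mem _ hinc.2.1 h))
      subst hcs
      rw [prune, if_pos rfl, prune_eq_self F haF]
      exact ⟨mem_insertions.2 (Or.inl rfl), hkF⟩
    rw [prune, if_neg hal]
    rcases hmem with rfl | hmem | hmem
    · exact absurd rfl hal
    · obtain ⟨h1, h2⟩ := ihcs hlcs hmem hndcs hinc.2.1 hkcs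
      rw [prune_eq_self F (hdisj hmem)]
      refine ⟨mem_insertions.2 (Or.inr (mem_innerInsertions_cons.2 (Or.inl ⟨_, h1, rfl⟩))),
        forestKlazar_cons.2 ⟨fun u hu => ?_, h2, hkF⟩⟩
      obtain ⟨d, hd, hdu⟩ := hhead u hu
      have hul : u ≤ l := by
        obtain ⟨c, hc, rfl⟩ := List.mem_map.1 (List.takeWhile_subset _ hu)
        exact hlF _ (label_mem_forestLabels hc)
      have h : d.label ∈ (prune l cs).map label := by
        rw [map_label_prune, List.mem_filter]
        exact ⟨List.mem_map_of_mem hd, by simpa using (hdu.trans_le hul).ne⟩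
      obtain ⟨d', hd', he⟩ := List.mem_map.1 h
      exact ⟨d', hd', he ▸ hdu⟩
    · obtain ⟨h1, h2⟩ := ihF hlF hmem hndF hinc.2.2 hkF
      rw [prune_eq_self cs fun h => hdisj h hmem]
      have hal' : a < l := lt_of_le_of_ne (hl a (Or.inl rfl)) hal
      refine ⟨mem_insertions.2 (Or.inr (mem_innerInsertions_cons.2 (Or.inr ?_))),
        forestKlazar_cons.2 ⟨fun u hu => hhead u ?_, hkcs, h2⟩⟩
      · rcases mem_insertions.1 h1 with h | h
        · refine Or.inl ⟨?_, by rw [← h]⟩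
          -- The left neighbor of `l` has `l` at the start of its run, so it has a child: the
          -- insertion place is allowed.
          obtain ⟨d, hd, -⟩ := hhead l (by rw [h]; simp [label, hal'])
          exact List.ne_nil_of_mem hd
        · exact Or.inr ⟨_, h, rfl⟩
      · rw [map_label_prune] at hu
        refine mem_takeWhile_of_filter (fun x hx => ?_) hu
        have : x = l := by simpa using hx
        simpa [this] using hal'

end PlaneTree

open PlaneTree in
theorem encard_klazarTrees (n : ℕ) : (klazarTrees n).encard = pathCount n 0 1 := by
  classical
  refine encard_eq_pathCount klazarTrees
    (fun n T => (insertions (n + 1) T.children).toFinset.image (node T.label))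
    (fun n T => (leafCount T.children, slotCount T.children + 1)) (node 0 []) ?_ ?_ ?_ ?_ ?_ n
  · ext ⟨a, cs⟩
    simp only [klazarTrees, Set.mem_ofPred_eq, isKlazar_node_iff, Set.mem_singleton_iff]
    constructor
    · rintro ⟨h, -⟩
      have hlen := h.length_eq
      rcases cs with _ | ⟨⟨b, ds⟩, cs⟩
      · simpa using h
      · simp at hlen
    · intro h
      obtain ⟨rfl, rfl⟩ := node.inj h
      exact ⟨by simp, forestIncreasing_nil, forestKlazar_nil⟩
  · simp [children, leafCount, slotCount]
  · rintro n ⟨a, cs⟩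
    simp only [klazarTrees, Set.mem_ofPred_eq, Finset.mem_image, List.mem_toFinset]
    constructor
    · intro h
      obtain ⟨hperm, hinc, hk⟩ := isKlazar_node_iff.1 h
      have hle : ∀ x ∈ a :: forestLabels cs, x ≤ n + 1 := fun x hx => by
        have := hperm.subset hx
        simpa [Nat.lt_succ_iff] using this
      have hmem : ∀ x, x ≤ n + 1 → x ∈ a :: forestLabels cs := fun x hx =>
        hperm.symm.subset (by simpa [Nat.lt_succ_iff] using hx)
      have hne : a ≠ n + 1 := by
        intro he
        rcases List.mem_cons.1 (hmem 0 (Nat.zero_le _)) with h0 | h0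
        · omega
        · have := ForestIncreasing.lt_of_mem _ hinc h0
          omega
      have hmem' : n + 1 ∈ forestLabels cs :=
        (List.mem_cons.1 (hmem (n + 1) le_rfl)).resolve_left hne.symm
      have hnd : (a :: forestLabels cs).Nodup := hperm.nodup_iff.2 List.nodup_range
      obtain ⟨h1, h2⟩ := mem_insertions_prune cs (fun x hx => hle x (List.mem_cons_of_mem _ hx))
        hmem' (List.nodup_cons.1 hnd).2 hinc hk
      refine ⟨node a (prune (n + 1) cs), isKlazar_node_iff.2 ⟨?_, forestIncreasing_prune _ hinc, h2⟩,
        cs, h1, rfl⟩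
      have hp := ((forestLabels_perm_of_mem_insertions _ _ h1).cons a).symm.trans hperm
      rw [List.range_succ] at hp
      exact ((List.Perm.swap _ _ _).trans
        (hp.trans (List.perm_append_singleton _ _))).cons_inv
    · rintro ⟨⟨b, ds⟩, hT, G, hG, heq⟩
      obtain ⟨rfl, rfl⟩ := node.inj heq
      obtain ⟨hperm, hinc, hk⟩ := isKlazar_node_iff.1 hT
      have hlt : ∀ x ∈ b :: forestLabels ds, x < n + 1 := fun x hx => by
        simpa using hperm.subset hx
      have hltds : ∀ x ∈ forestLabels ds, x < n + 1 := fun x hx => hlt x (List.mem_cons_of_mem _ hx)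
      refine isKlazar_node_iff.2 ⟨?_, forestIncreasing_of_mem_insertions ds
        (hlt b List.mem_cons_self) hltds hinc G hG, forestKlazar_of_mem_insertions ds hltds hk G hG⟩
      refine ((forestLabels_perm_of_mem_insertions _ _ hG).cons _).trans
        ((List.Perm.swap _ _ _).trans ((hperm.cons (n + 1)).trans ?_))
      rw [List.range_succ (n := n + 1)]
      exact (List.perm_append_singleton _ _).symm
  · rintro n ⟨a, cs⟩ hT ⟨a', cs'⟩ hT' T h h'
    have hnot : ∀ a cs, node a cs ∈ klazarTrees n → n + 1 ∉ forestLabels cs := by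
      intro a cs hT h
      have := (isKlazar_node_iff.1 hT).1.subset (List.mem_cons_of_mem _ h)
      simp at this
    obtain ⟨G, hG, rfl⟩ := Finset.mem_image.1 h
    obtain ⟨G', hG', he⟩ := Finset.mem_image.1 h'
    obtain ⟨hlabel, rfl⟩ := node.inj he
    rw [List.mem_toFinset] at hG hG'
    have h1 := prune_of_mem_insertions _ (hnot _ _ hT) _ hG
    have h2 := prune_of_mem_insertions _ (hnot _ _ hT') _ hG'
    simp only [label] at hlabel
    rw [hlabel, ← h1, h2]
  · intro n T _ g
    rw [Finset.sum_image fun G _ G' _ h => (node.inj h).2,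
      List.sum_toFinset _ (nodup_insertions _ _)]
    exact sum_insertions (n + 1) _ g

/-! ### Packed functions compatible with a signed ranking -/

theorem encard_eq_of_biunique {α β : Type*} {X : Set α} {Y : Set β} (R : α → β → Prop)
    (hX : ∀ x ∈ X, ∃ y ∈ Y, R x y) (hY : ∀ y ∈ Y, ∃ x ∈ X, R x y)
    (hl : ∀ x ∈ X, ∀ x' ∈ X, ∀ y ∈ Y, R x y → R x' y → x = x')
    (hr : ∀ x ∈ X, ∀ y ∈ Y, ∀ y' ∈ Y, R x y → R x y' → y = y') : X.encard = Y.encard := by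
  choose F hFY hF using hX
  refine Set.encard_congr (Equiv.ofBijective (fun x : X => ⟨F x x.2, hFY x x.2⟩) ⟨?_, ?_⟩)
  · rintro ⟨x, hx⟩ ⟨x', hx'⟩ h
    have h' : F x hx = F x' hx' := congrArg Subtype.val h
    exact Subtype.ext (hl x hx x' hx' _ (hFY x hx) (hF x hx) (h' ▸ hF x' hx'))
  · rintro ⟨y, hy⟩
    obtain ⟨x, hx, hxy⟩ := hY y hy
    exact ⟨⟨x, hx⟩, Subtype.ext (hr x hx _ (hFY x hx) y hy (hF x hx) hxy)⟩

theorem encard_evenMin (n : ℕ) : (evenMin (Fin n)).encard = pathCount n 0 1 := by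
  rw [← card_evenMin, Nat.card_coe_set_eq, (Set.toFinite _).cast_ncard_eq]

section Compatible

variable {ι : Type*}

/-- The sign of each element is given by the parity of its block index, and the ranking `r`
respects the order of blocks of opposite sign. -/
def Compatible (r : ι → ℝ) (s : ι → ℤˣ) (f : ι → ℕ) : Prop :=
  (∀ i, s i = (-1) ^ f i) ∧ ∀ i j, f i < f j → s i ≠ s j → r i < r j

variable {r : ι → ℝ} {s : ι → ℤˣ} {f f' : ι → ℕ}

theorem neg_one_pow_eq_iff {a b : ℕ} : (-1 : ℤˣ) ^ a = (-1) ^ b ↔ (Even a ↔ Even b) := by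
  rcases Nat.even_or_odd a with ha | ha <;> rcases Nat.even_or_odd b with hb | hb
  · simp [ha.neg_one_pow, hb.neg_one_pow, ha, hb]
  · simp [ha.neg_one_pow, hb.neg_one_pow, ha, Nat.not_even_iff_odd.2 hb]
  · simp [ha.neg_one_pow, hb.neg_one_pow, hb, Nat.not_even_iff_odd.2 ha]
  · simp [ha.neg_one_pow, hb.neg_one_pow, Nat.not_even_iff_odd.2 ha, Nat.not_even_iff_odd.2 hb]

theorem Compatible.sign_eq_iff (h : Compatible r s f) {i j : ι} :
    s i = s j ↔ (Even (f i) ↔ Even (f j)) := by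
  rw [h.1, h.1, neg_one_pow_eq_iff]

theorem Compatible.sign_eq_one_iff (h : Compatible r s f) {i : ι} : s i = 1 ↔ Even (f i) := by
  have := neg_one_pow_eq_iff (a := f i) (b := 0)
  rw [pow_zero] at this
  rw [h.1, this]
  simp

/-- Packedness of `f` gives a predecessor j of i of opposite sign, index one less and lower rank. If
f' i < f i, induction on j and parity force f' i < f' j, so i would rank below j. -/
theorem Compatible.le (h : Compatible r s f) (h' : Compatible r s f') (hf : IsPacked f) (i : ι) :
    f i ≤ f' i := by
  induction hk : f i generalizing i with
  | zero => exact Nat.zero_le _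
  | succ k ih =>
    obtain ⟨j, hj⟩ := hf i k (by omega)
    have hne : s j ≠ s i := by
      rw [Ne, h.sign_eq_iff, hj, hk, Nat.even_add_one]
      tauto
    have hr := h.2 j i (by omega) hne
    have hj' := ih j hj
    by_contra! hlt
    have hne' : f' i ≠ f' j := fun he => hne (by rw [h'.sign_eq_iff, he])
    exact absurd (h'.2 i j (by omega) hne.symm) (not_lt.2 hr.le)

theorem Compatible.unique (h : Compatible r s f) (h' : Compatible r s f') (hf : IsPacked f)
    (hf' : IsPacked f') : f = f' :=
  funext fun i => le_antisymm (h.le h' hf i) (h'.le h hf' i)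

/-- For two blocks of equal sign, packedness supplies an element in an intermediate block of
opposite sign through which the ranks can be compared. -/
theorem Compatible.lt (h : Compatible r s f) (hf : IsPacked f) {i j : ι} (hij : f i < f j) :
    r i < r j := by
  by_cases hs : s i = s j
  · have hpar := h.sign_eq_iff.1 hs
    have h1 : f i + 1 ≠ f j := by
      intro he
      rw [← he, Nat.even_add_one] at hpar
      tauto
    obtain ⟨k, hk⟩ := hf j (f i + 1) (by omega)
    have hik : s i ≠ s k := by
      rw [Ne, h.sign_eq_iff, hk, Nat.even_add_one]
      tauto
    exact (h.2 i k (by omega) hik).trans (h.2 k j (by omega) (hs ▸ hik.symm))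
  · exact h.2 i j hij hs

/-- Well-founded recursion on the rank. The value is the length of the longest chain of rising rank
and alternating sign that ends below `i` with an element of the other sign; the empty supremum is 0.
-/
theorem exists_eq_sup [Fintype ι] (r : ι → ℝ) (s : ι → ℤˣ) : ∃ f : ι → ℕ, ∀ i,
    f i = (Finset.univ.filter fun j => r j < r i ∧ s j ≠ s i).sup fun j => f j + 1 := by
  classical
  have wf : WellFounded fun i j : ι => r i < r j :=
    haveI : IsTrans ι fun i j => r i < r j := ⟨fun _ _ _ => lt_trans⟩
    haveI : Std.Irrefl fun i j : ι => r i < r j := ⟨fun _ => lt_irrefl _⟩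
    Finite.wellFounded_of_trans_of_irrefl _
  let step : ∀ i : ι, (∀ j, r j < r i → ℕ) → ℕ := fun i F =>
    (Finset.univ.filter fun j => r j < r i ∧ s j ≠ s i).sup
      fun j => if h : r j < r i then F j h + 1 else 0
  refine ⟨wf.fix step, fun i => ?_⟩
  rw [wf.fix_eq]
  refine Finset.sup_congr rfl fun j hj => ?_
  rw [dif_pos (Finset.mem_filter.1 hj).2.1]

/-- Take the longest alternating chain length. The hypothesis `htop` forces elements of value 0 to
be positive, which fixes the parity, and `hrs` excludes ties between opposite signs. -/
theorem exists_compatible [Fintype ι] (hrs : ∀ i j, s i ≠ s j → r i ≠ r j)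
    (htop : ∀ i, s i = -1 → ∃ j, s j = 1 ∧ r j < r i) : ∃ f, IsPacked f ∧ Compatible r s f := by
  obtain ⟨f, hf⟩ := exists_eq_sup r s
  have hlt : ∀ i j, r j < r i → s j ≠ s i → f j < f i := by
    intro i j h1 h2
    rw [hf i]
    exact Finset.le_sup (f := fun j => f j + 1) (by simpa using ⟨h1, h2⟩)
  have hex : ∀ i k, f i = k + 1 → ∃ j, r j < r i ∧ s j ≠ s i ∧ f j = k := by
    intro i k hk
    have hne : (Finset.univ.filter fun j => r j < r i ∧ s j ≠ s i).Nonempty := by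
      by_contra hne
      rw [Finset.not_nonempty_iff_eq_empty] at hne
      rw [hf i, hne, Finset.sup_empty] at hk
      exact absurd hk (by simp)
    obtain ⟨j, hj, hji⟩ := Finset.exists_mem_eq_sup _ hne fun j => f j + 1
    rw [← hf i] at hji
    simp only [Finset.mem_filter, Finset.mem_univ, true_and] at hj
    exact ⟨j, hj.1, hj.2, by omega⟩
  refine ⟨f, fun i => ?_, fun i => ?_, fun i j hij hs => ?_⟩
  · induction hk : f i generalizing i with
    | zero => intro k hk; omega
    | succ k ih =>
      intro k' hk'
      obtain ⟨j, -, -, hj⟩ := hex i k hk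
      rcases (Nat.lt_succ_iff.1 hk').lt_or_eq with h | rfl
      · exact ih j hj k' h
      · exact ⟨j, hj⟩
  · induction hk : f i generalizing i with
    | zero =>
      rcases Int.units_eq_one_or (s i) with h | h
      · simpa using h
      · obtain ⟨j, hj, hji⟩ := htop i h
        have := hlt i j hji (by rw [hj, h]; decide)
        omega
    | succ k ih =>
      obtain ⟨j, -, hs, hj⟩ := hex i k hk
      rw [pow_succ, ← ih j hj]
      rw [Int.units_ne_iff_eq_neg.1 hs]
      simp
  · rcases lt_or_gt_of_ne (hrs i j hs) with h | h
    · exact h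
    · have := hlt i j h hs.symm
      omega

end Compatible

/-- Let m' be the least element whose index is at most f m. It is a left-to-right minimum, so f m'
is even. If f m' < f m, then m' would lie in `S`, hence m ≤ m', which is impossible; so the two
indices agree. This is applied to prefixes of a permutation and to level sets of |x|. -/
theorem even_of_isLeast {n : ℕ} {f : Fin n → ℕ} (hf : f ∈ evenMin (Fin n)) {S : Set (Fin n)}
    (hS : ∀ j ∈ S, ∀ i, f i < f j → i ∈ S) {m : Fin n} (hm : IsLeast S m) : Even (f m) := by
  obtain ⟨m', hm'⟩ := (Set.toFinite {v | f v ≤ f m}).exists_minimal ⟨m, le_refl (f m)⟩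
  have hlow : ∀ j < m', f m < f j := by
    intro j hj
    by_contra! hle
    exact absurd (hm'.2 hle hj.le) (not_le.2 hj)
  have heven := hf.2 m' fun j hj => lt_of_le_of_lt hm'.1 (hlow j hj)
  have hle : f m' ≤ f m := hm'.1
  rcases hle.lt_or_eq with h | h
  · rcases (hm.2 (hS m hm.1 m' h)).lt_or_eq with hlt | rfl
    · exact absurd (hlow m hlt) (lt_irrefl _)
    · exact absurd h (lt_irrefl _)
  · rwa [← h]

/-! ### Signed permutations -/

namespace SignedPermutation

variable {n : ℕ}

/-- The position of a value, as a real number. -/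
def rank (p : SignedPermutation n) (v : Fin n) : ℝ := (p.a.symm v : ℕ)

theorem rank_lt_rank {p : SignedPermutation n} {v w : Fin n} :
    p.rank v < p.rank w ↔ p.a.symm v < p.a.symm w := by
  simp [rank]

/-- A negative value is preceded by the minimum of its prefix, which is positive; this starts every
chain with a plus. Conversely, a value below every smaller value in block order is the minimum of
the prefix that ends with it. -/
theorem exists_compatible {p : SignedPermutation n} (hp : p ∈ positiveMinSignedPerms n) :
    ∃ f ∈ evenMin (Fin n), Compatible p.rank p.σ f := by
  obtain ⟨f, hf, hc⟩ := PlaneTreeDrawings.exists_compatible (r := p.rank) (s := p.σ)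
    (fun i j hs h => by
      have : i = j := by
        have h' : p.a.symm i = p.a.symm j := Fin.ext (Nat.cast_injective (R := ℝ) h)
        exact p.a.symm.injective h'
      exact hs (this ▸ rfl))
    (fun i hi => by
      obtain ⟨m, hm⟩ := (Set.toFinite (p.a '' Set.Iic (p.a.symm i))).exists_minimal
        ⟨i, p.a.symm i, by simp, by simp⟩
      have hleast : IsLeast (p.a '' Set.Iic (p.a.symm i)) m :=
        ⟨hm.1, fun x hx => by
          by_contra! hlt
          exact absurd (hm.2 hx hlt.le) (not_le.2 hlt)⟩
      have hσ := hp.2 m ⟨_, hleast⟩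
      refine ⟨m, hσ, rank_lt_rank.2 (lt_of_le_of_ne ?_ fun h => ?_)⟩
      · obtain ⟨k, hk, rfl⟩ := hleast.1
        simpa using hk
      · rw [p.a.symm.injective h, hi] at hσ
        exact absurd hσ (by decide))
  refine ⟨f, ⟨hf, fun m hm => hc.sign_eq_one_iff.1 (hp.2 m ⟨p.a.symm m, ⟨p.a.symm m, by simp⟩, ?_⟩)⟩,
    hc⟩
  · rintro _ ⟨k, hk, rfl⟩
    by_contra! hlt
    have := rank_lt_rank.1 (hc.lt hf (hm _ hlt))
    rw [Equiv.symm_apply_apply] at this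
    exact absurd hk (not_le.2 this)

/-- Sort by block index, and decreasingly within the blocks. -/
def sortKey (f : Fin n → ℕ) (v : Fin n) : ℕ ×ₗ (Fin n)ᵒᵈ := toLex (f v, OrderDual.toDual v)

theorem sortKey_lt {f : Fin n → ℕ} {v w : Fin n} :
    sortKey f v < sortKey f w ↔ f v < f w ∨ f v = f w ∧ w < v := by
  simp [sortKey, Prod.Lex.toLex_lt_toLex]

theorem sortKey_injective (f : Fin n → ℕ) : Function.Injective (sortKey f) := by
  intro v w h
  simp only [sortKey, EmbeddingLike.apply_eq_iff_eq, Prod.mk.injEq] at h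
  exact h.2

/-- The signed permutation that lists the blocks in decreasing order with alternating signs. -/
def ofPacked (f : Fin n → ℕ) : SignedPermutation n where
  a := Tuple.sort (sortKey f)
  σ v := (-1) ^ f v

theorem strictMono_ofPacked (f : Fin n → ℕ) : StrictMono (sortKey f ∘ (ofPacked f).a) :=
  (Tuple.monotone_sort (sortKey f)).strictMono_of_injective
    ((sortKey_injective f).comp (ofPacked f).a.injective)

theorem symm_ofPacked_lt {f : Fin n → ℕ} {v w : Fin n} :
    (ofPacked f).a.symm v < (ofPacked f).a.symm w ↔ f v < f w ∨ f v = f w ∧ w < v := by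
  rw [← (strictMono_ofPacked f).lt_iff_lt, Function.comp_apply, Function.comp_apply,
    Equiv.apply_symm_apply, Equiv.apply_symm_apply, sortKey_lt]

theorem compatible_ofPacked (f : Fin n → ℕ) :
    Compatible (ofPacked f).rank (ofPacked f).σ f :=
  ⟨fun _ => rfl, fun _ _ h _ => rank_lt_rank.2 (symm_ofPacked_lt.2 (Or.inl h))⟩

theorem ofPacked_mem {f : Fin n → ℕ} (hf : f ∈ evenMin (Fin n)) :
    ofPacked f ∈ positiveMinSignedPerms n := by
  have hc := compatible_ofPacked f
  refine ⟨fun i j hij hs => ?_, ?_⟩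
  · have hlt : i < j := by rw [Fin.lt_def]; omega
    rcases sortKey_lt.1 (strictMono_ofPacked f hlt) with h | h
    · have hpar := hc.sign_eq_iff.1 hs
      have h1 : f ((ofPacked f).a i) + 1 ≠ f ((ofPacked f).a j) := by
        intro he
        rw [← he, Nat.even_add_one] at hpar
        tauto
      obtain ⟨k, hk⟩ := hf.1 ((ofPacked f).a j) (f ((ofPacked f).a i) + 1) (by omega)
      have h2 := (symm_ofPacked_lt (f := f) (v := (ofPacked f).a i) (w := k)).2
        (Or.inl (by omega))
      have h3 := (symm_ofPacked_lt (f := f) (v := k) (w := (ofPacked f).a j)).2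
        (Or.inl (by omega))
      rw [Equiv.symm_apply_apply, Fin.lt_def] at h2 h3
      omega
    · exact h.2
  · rintro m ⟨i, hm⟩
    rw [hc.sign_eq_one_iff]
    refine even_of_isLeast hf ?_ hm
    rintro _ ⟨k, hk, rfl⟩ v hv
    refine ⟨(ofPacked f).a.symm v, ?_, by simp⟩
    have hpos := symm_ofPacked_lt.2 (Or.inl hv)
    rw [Equiv.symm_apply_apply] at hpos
    exact hpos.le.trans hk

/-- The block function dictates the whole listing, since adjacent entries are increasing in
`sortKey`. Two permutations with the same block function then coincide, as strictly monotone maps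
with equal range. -/
theorem strictMono_of_compatible {p : SignedPermutation n} (hp : p.HasDecreasingBlocks)
    {f : Fin n → ℕ} (hf : IsPacked f) (hc : Compatible p.rank p.σ f) :
    StrictMono (sortKey f ∘ p.a) := by
  rcases n with _ | n
  · exact fun i => i.elim0
  refine Fin.strictMono_iff_lt_succ.2 fun i => ?_
  rw [Function.comp_apply, Function.comp_apply, sortKey_lt]
  rcases lt_trichotomy (f (p.a i.castSucc)) (f (p.a i.succ)) with h | h | h
  · exact Or.inl h
  · exact Or.inr ⟨h, hp _ _ (by simp) (hc.sign_eq_iff.2 (by rw [h]))⟩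
  · have := rank_lt_rank.1 (hc.lt hf h)
    rw [Equiv.symm_apply_apply, Equiv.symm_apply_apply, Fin.lt_def] at this
    simp at this

end SignedPermutation

theorem encard_positiveMinSignedPerms (n : ℕ) :
    (positiveMinSignedPerms n).encard = pathCount n 0 1 := by
  rw [← encard_evenMin]
  refine encard_eq_of_biunique (fun p f => Compatible p.rank p.σ f)
    (fun p hp => SignedPermutation.exists_compatible hp)
    (fun f hf => ⟨_, SignedPermutation.ofPacked_mem hf, SignedPermutation.compatible_ofPacked f⟩)
    ?_ fun p _ f hf f' hf' h h' => h.unique h' hf.1 hf'.1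
  intro p hp p' hp' f hf h h'
  have h1 := SignedPermutation.strictMono_of_compatible hp.1 hf.1 h
  have h2 := SignedPermutation.strictMono_of_compatible hp'.1 hf.1 h'
  have h3 : SignedPermutation.sortKey f ∘ p.a = SignedPermutation.sortKey f ∘ p'.a := by
    rw [← StrictMono.range_inj h1 h2, p.a.surjective.range_comp, p'.a.surjective.range_comp]
  ext v
  · exact congrArg Fin.val (SignedPermutation.sortKey_injective f (congrFun h3 v))
  · rw [h'.1, h.1 v, Units.val_pow_eq_pow_val]

/-! ### Ordered partitions -/

namespace OrderedPartition

variable {n : ℕ}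

/-- `f` gives the index of the block that contains an element. -/
def HasIndex (A : OrderedPartition n) (f : Fin n → ℕ) : Prop :=
  ∀ i, ∃ h : f i < A.blocks.length, i ∈ A.blocks[f i]

theorem index_unique {A : OrderedPartition n} {x : Fin n} {a b : ℕ} {ha : a < A.blocks.length}
    {hb : b < A.blocks.length} (hxa : x ∈ A.blocks[a]) (hxb : x ∈ A.blocks[b]) : a = b := by
  by_contra hne
  rcases lt_or_gt_of_ne hne with h | h
  · exact Finset.disjoint_left.1 (List.pairwise_iff_getElem.1 A.disjoint a b ha hb h) hxa hxb
  · exact Finset.disjoint_left.1 (List.pairwise_iff_getElem.1 A.disjoint b a hb ha h) hxb hxa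

theorem HasIndex.mem_iff {A : OrderedPartition n} {f : Fin n → ℕ} (h : A.HasIndex f) {x : Fin n}
    {k : ℕ} {hk : k < A.blocks.length} : x ∈ A.blocks[k] ↔ f x = k := by
  obtain ⟨hx, hxf⟩ := h x
  constructor
  · exact fun hxk => index_unique hxf hxk
  · rintro rfl
    exact hxf

theorem exists_mem_take_iff {A : OrderedPartition n} {f : Fin n → ℕ} (h : A.HasIndex f) {x : Fin n}
    {i : ℕ} : (∃ B ∈ A.blocks.take i, x ∈ B) ↔ f x < i := by
  constructor
  · rintro ⟨B, hB, hx⟩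
    obtain ⟨k, hk, rfl⟩ := List.mem_iff_getElem.1 hB
    rw [List.getElem_take, h.mem_iff] at hx
    rw [List.length_take] at hk
    omega
  · intro hi
    obtain ⟨hx, hxf⟩ := h x
    refine ⟨A.blocks[f x], List.mem_iff_getElem.2 ⟨f x, ?_, ?_⟩, hxf⟩
    · rw [List.length_take]
      omega
    · rw [List.getElem_take]

theorem exists_index {A : OrderedPartition n} (hA : A ∈ oddMinPartitions n) :
    ∃ f ∈ evenMin (Fin n), A.HasIndex f := by
  have : ∀ i, ∃ k, ∃ h : k < A.blocks.length, i ∈ A.blocks[k] := by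
    intro i
    obtain ⟨B, hB, hi⟩ := A.cover i
    obtain ⟨k, hk, rfl⟩ := List.mem_iff_getElem.1 hB
    exact ⟨k, hk, hi⟩
  choose f hf using this
  have hI : A.HasIndex f := hf
  refine ⟨f, ⟨fun i k hk => ?_, fun m hm => ?_⟩, hI⟩
  · have hk' : k < A.blocks.length := hk.trans (hf i).1
    obtain ⟨j, hj⟩ := A.nonempty _ (List.getElem_mem hk')
    exact ⟨j, hI.mem_iff.1 hj⟩
  -- Indices start at 0, so the prefix that ends with the block of `m` has f m + 1 blocks.
  · have hleast : IsLeast {x | ∃ B ∈ A.blocks.take (f m + 1), x ∈ B} m := by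
      refine ⟨(exists_mem_take_iff hI).2 (Nat.lt_succ_self _), fun x hx => ?_⟩
      have hx' := (exists_mem_take_iff hI).1 hx
      by_contra! hlt
      have := hm x hlt
      omega
    obtain ⟨j, hj, hje, hmj⟩ := hA m ⟨f m + 1, by omega, (hf m).1, hleast⟩
    rwa [hI.mem_iff.1 hmj]

theorem exists_of_packed {f : Fin n → ℕ} (hf : f ∈ evenMin (Fin n)) :
    ∃ A ∈ oddMinPartitions n, A.HasIndex f := by
  obtain ⟨K, hK, hK'⟩ : ∃ K, (∀ i, f i < K) ∧ ∀ k < K, ∃ i, f i = k := by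
    rcases isEmpty_or_nonempty (Fin n) with h | h
    · exact ⟨0, fun i => h.elim i, fun k hk => by omega⟩
    · obtain ⟨i, hi⟩ := Finite.exists_max f
      refine ⟨f i + 1, fun j => Nat.lt_succ_of_le (hi j), fun k hk => ?_⟩
      rcases (Nat.lt_succ_iff.1 hk).lt_or_eq with h | rfl
      · exact hf.1 i k h
      · exact ⟨i, rfl⟩
  let A : OrderedPartition n :=
    { blocks := (List.range K).map fun k => Finset.univ.filter (f · = k)
      nonempty := by
        intro B hB
        obtain ⟨k, hk, rfl⟩ := List.mem_map.1 hB
        obtain ⟨i, hi⟩ := hK' k (List.mem_range.1 hk)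
        exact ⟨i, by simpa using hi⟩
      disjoint := by
        rw [List.pairwise_map]
        refine List.Pairwise.imp (fun {a b} hab => ?_) List.pairwise_lt_range
        rw [Finset.disjoint_left]
        intro x hx hx'
        simp only [Finset.mem_filter, Finset.mem_univ, true_and] at hx hx'
        omega
      cover := fun x => ⟨Finset.univ.filter (f · = f x),
        List.mem_map.2 ⟨f x, List.mem_range.2 (hK x), rfl⟩, by simp⟩ }
  have hA : A.HasIndex f := fun i => ⟨by simpa [A] using hK i, by simp [A]⟩
  refine ⟨A, ?_, hA⟩
  rintro m ⟨i, -, -, hm, hmin⟩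
  obtain ⟨hm', hmf⟩ := hA m
  refine ⟨f m, hm', hf.2 m fun j hj => ?_, hmf⟩
  have h1 := (exists_mem_take_iff hA).1 hm
  by_contra! hle
  exact absurd (hmin ((exists_mem_take_iff hA).2 (hle.trans_lt h1))) (not_le.2 hj)

theorem length_le_of_hasIndex {A A' : OrderedPartition n} {f : Fin n → ℕ} (h : A.HasIndex f)
    (h' : A'.HasIndex f) : A.blocks.length ≤ A'.blocks.length := by
  by_contra! hlt
  obtain ⟨x, hx⟩ := A.nonempty _ (List.getElem_mem hlt)
  have := (h' x).1
  rw [h.mem_iff.1 hx] at this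
  exact lt_irrefl _ this

theorem eq_of_hasIndex {A A' : OrderedPartition n} {f : Fin n → ℕ} (h : A.HasIndex f)
    (h' : A'.HasIndex f) : A = A' := by
  ext1
  refine List.ext_getElem (le_antisymm (length_le_of_hasIndex h h') (length_le_of_hasIndex h' h))
    fun k hk hk' => ?_
  ext x
  rw [h.mem_iff, h'.mem_iff]

end OrderedPartition

theorem encard_oddMinPartitions (n : ℕ) : (oddMinPartitions n).encard = pathCount n 0 1 := by
  rw [← encard_evenMin]
  refine encard_eq_of_biunique (fun A f => A.HasIndex f)
    (fun A hA => OrderedPartition.exists_index hA)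
    (fun f hf => OrderedPartition.exists_of_packed hf)
    (fun A _ A' _ f _ h h' => OrderedPartition.eq_of_hasIndex h h') ?_
  intro A _ f _ f' _ h h'
  funext i
  obtain ⟨hi, hif⟩ := h' i
  exact h.mem_iff.1 hif

/-! ### Chambers of the arrangement -/

section Regions

variable {n : ℕ}

/-- The point lies on no hyperplane of the arrangement. -/
def IsGeneric (x : Fin n → ℝ) : Prop := (∀ i, x i ≠ 0) ∧ ∀ i j, i ≠ j → x i + x j ≠ 0

theorem mem_complement_iff {l x : Fin n → ℝ} :
    x ∈ slice l \ ⋃ H ∈ arrangement n, H ∩ slice l ↔ x ∈ slice l ∧ IsGeneric x := by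
  simp only [Set.mem_sdiff, Set.mem_iUnion, Set.mem_inter_iff, not_exists, not_and]
  refine and_congr_right fun hx => ⟨fun h => ⟨fun i hi => ?_, fun i j hij hs => ?_⟩, ?_⟩
  · exact h _ (Or.inl ⟨i, rfl⟩) hi hx
  · rcases lt_or_gt_of_ne hij with hlt | hlt
    · exact h _ (Or.inr ⟨i, j, hlt, rfl⟩) hs hx
    · exact h _ (Or.inr ⟨j, i, hlt, rfl⟩) ((add_comm _ _).trans hs) hx
  · rintro ⟨h1, h2⟩ H (⟨i, rfl⟩ | ⟨i, j, hij, rfl⟩) hH -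
    · exact h1 i hH
    · exact h2 i j hij.ne hH

/-- The chamber of points in which the entries with block index `k` have the sign `(-1) ^ k`, and
larger absolute values than the entries of opposite sign with larger block index. -/
def chamber (f : Fin n → ℕ) : Set (Fin n → ℝ) :=
  {x | (∀ i, 0 < (-1) ^ f i * x i) ∧
    ∀ i j, f i < f j → ¬ (Even (f i) ↔ Even (f j)) → 0 < (-1) ^ f i * (x i + x j)}

/-- The signs of the entries of a vector. -/
noncomputable def signVector (x : Fin n → ℝ) (i : Fin n) : ℤˣ := if 0 < x i then 1 else -1

/-- For entries of opposite sign, the sign of their sum tells which absolute value is larger.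
Ranking by -|x| puts large absolute values into early blocks. -/
theorem mem_chamber_iff {f : Fin n → ℕ} {x : Fin n → ℝ} :
    x ∈ chamber f ↔ (∀ i, x i ≠ 0) ∧ Compatible (fun i => -|x i|) (signVector x) f := by
  constructor
  · rintro ⟨h1, h2⟩
    have hs : ∀ i, signVector x i = (-1) ^ f i := by
      intro i
      have := h1 i
      rcases Nat.even_or_odd (f i) with h | h
      · rw [h.neg_one_pow] at this ⊢
        simp only [signVector]
        rw [if_pos (by linarith)]
      · rw [h.neg_one_pow] at this ⊢
        simp only [signVector]
        rw [if_neg (by linarith)]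
    refine ⟨fun i hi => ?_, hs, fun i j hij hne => ?_⟩
    · have := h1 i
      simp [hi] at this
    · rw [hs, hs, Ne, neg_one_pow_eq_iff] at hne
      have h3 := h2 i j hij hne
      have hi := h1 i
      have hj := h1 j
      rcases Nat.even_or_odd (f i) with h | h <;> rcases Nat.even_or_odd (f j) with h' | h'
      · exact absurd (iff_of_true h h') hne
      · rw [h.neg_one_pow] at h3 hi
        rw [h'.neg_one_pow] at hj
        simp only
        rw [abs_of_pos (a := x i) (by linarith), abs_of_neg (a := x j) (by linarith)]
        linarith
      · rw [h.neg_one_pow] at h3 hi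
        rw [h'.neg_one_pow] at hj
        simp only
        rw [abs_of_neg (a := x i) (by linarith), abs_of_pos (a := x j) (by linarith)]
        linarith
      · exact absurd (iff_of_false (Nat.not_even_iff_odd.2 h) (Nat.not_even_iff_odd.2 h')) hne
  · rintro ⟨h0, hc⟩
    have hpos : ∀ i, Even (f i) → 0 < x i := by
      intro i hi
      have := hc.sign_eq_one_iff.2 hi
      by_contra hx
      rw [signVector, if_neg hx] at this
      exact absurd this (by decide)
    have hneg : ∀ i, Odd (f i) → x i < 0 := by
      intro i hi
      refine lt_of_le_of_ne (not_lt.1 fun hx => ?_) (h0 i)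
      have : signVector x i = 1 := by rw [signVector, if_pos hx]
      exact absurd (hc.sign_eq_one_iff.1 this) (Nat.not_even_iff_odd.2 hi)
    refine ⟨fun i => ?_, fun i j hij hne => ?_⟩
    · rcases Nat.even_or_odd (f i) with h | h
      · rw [h.neg_one_pow, one_mul]
        exact hpos i h
      · rw [h.neg_one_pow]
        linarith [hneg i h]
    · have h3 := hc.2 i j hij (by rwa [Ne, hc.sign_eq_iff])
      simp only at h3
      rcases Nat.even_or_odd (f i) with h | h <;> rcases Nat.even_or_odd (f j) with h' | h'
      · exact absurd (iff_of_true h h') hne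
      · rw [abs_of_pos (hpos i h), abs_of_neg (hneg j h')] at h3
        rw [h.neg_one_pow]
        linarith
      · rw [abs_of_neg (hneg i h), abs_of_pos (hpos j h')] at h3
        rw [h.neg_one_pow]
        linarith
      · exact absurd (iff_of_false (Nat.not_even_iff_odd.2 h) (Nat.not_even_iff_odd.2 h')) hne

theorem isGeneric_of_mem_chamber {f : Fin n → ℕ} {x : Fin n → ℝ} (hx : x ∈ chamber f) :
    IsGeneric x := by
  obtain ⟨h1, h2⟩ := hx
  refine ⟨fun i hi => by simpa [hi] using h1 i, fun i j _ hs => ?_⟩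
  by_cases hpar : Even (f i) ↔ Even (f j)
  · have hi := h1 i
    have hj := h1 j
    have he : (-1 : ℝ) ^ f i = (-1) ^ f j := by
      rcases Nat.even_or_odd (f i) with h | h
      · rw [h.neg_one_pow, (hpar.1 h).neg_one_pow]
      · have h' : Odd (f j) :=
          Nat.not_even_iff_odd.1 fun h' => Nat.not_even_iff_odd.2 h (hpar.2 h')
        rw [h.neg_one_pow, h'.neg_one_pow]
    rw [← he] at hj
    have : 0 < (-1) ^ f i * (x i + x j) := by rw [mul_add]; exact add_pos hi hj
    simp [hs] at this
  · rcases lt_trichotomy (f i) (f j) with h | h | h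
    · have := h2 i j h hpar
      simp [hs] at this
    · exact hpar (by rw [h])
    · have := h2 j i h (fun h' => hpar h'.symm)
      rw [add_comm, hs] at this
      simp at this

theorem convex_chamber (f : Fin n → ℕ) : Convex ℝ (chamber f) := by
  have h : ∀ (L : (Fin n → ℝ) →ₗ[ℝ] ℝ), Convex ℝ {x | 0 < L x} := fun L =>
    convex_halfSpace_gt L.isLinear 0
  have he : chamber f = (⋂ i, {x | 0 < ((-1 : ℝ) ^ f i • LinearMap.proj (R := ℝ) (φ := fun _ => ℝ)
      i : (Fin n → ℝ) →ₗ[ℝ] ℝ) x}) ∩ ⋂ i, ⋂ j, ⋂ (_ : f i < f j),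
        ⋂ (_ : ¬ (Even (f i) ↔ Even (f j))), {x | 0 < ((-1 : ℝ) ^ f i •
          (LinearMap.proj (R := ℝ) (φ := fun _ => ℝ) i + LinearMap.proj j) :
            (Fin n → ℝ) →ₗ[ℝ] ℝ) x} := by
    ext x
    simp [chamber, mul_add]
  rw [he]
  exact (convex_iInter fun i => h _).inter
    (convex_iInter fun i => convex_iInter fun j => convex_iInter fun _ => convex_iInter fun _ => h _)

theorem convex_slice (l : Fin n → ℝ) : Convex ℝ (slice l) := by
  intro x hx y hy a b _ _ hab
  simp only [slice, Set.mem_ofPred_eq] at hx hy ⊢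
  calc ∑ i, l i * (a • x + b • y) i = a * ∑ i, l i * x i + b * ∑ i, l i * y i := by
        rw [Finset.mul_sum, Finset.mul_sum, ← Finset.sum_add_distrib]
        refine Finset.sum_congr rfl fun i _ => ?_
        simp only [Pi.add_apply, Pi.smul_apply, smul_eq_mul]
        ring
    _ = 1 := by rw [hx, hy, mul_one, mul_one, hab]

theorem isOpen_chamber (f : Fin n → ℕ) : IsOpen (chamber f) := by
  have he : chamber f = (⋂ i, {x : Fin n → ℝ | 0 < (-1 : ℝ) ^ f i * x i}) ∩
      ⋂ i, ⋂ j, {x : Fin n → ℝ | f i < f j → ¬ (Even (f i) ↔ Even (f j)) →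
        0 < (-1 : ℝ) ^ f i * (x i + x j)} := by
    ext x
    simp [chamber]
  rw [he]
  refine IsOpen.inter (isOpen_iInter_of_finite fun i => ?_)
    (isOpen_iInter_of_finite fun i => isOpen_iInter_of_finite fun j => ?_)
  · exact isOpen_lt continuous_const (by fun_prop)
  · by_cases h1 : f i < f j
    · by_cases h2 : Even (f i) ↔ Even (f j)
      · simp [h2]
      · simp only [h1, h2, not_false_eq_true, forall_const]
        exact isOpen_lt continuous_const (by fun_prop)
    · simp [h1]

/-- The points which are strictly on the other side of a wall of the chamber. -/
def beyondChamber (f : Fin n → ℕ) : Set (Fin n → ℝ) :=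
  (⋃ i, {x | (-1) ^ f i * x i < 0}) ∪
    ⋃ i, ⋃ j, ⋃ (_ : f i < f j), ⋃ (_ : ¬ (Even (f i) ↔ Even (f j))),
      {x | (-1) ^ f i * (x i + x j) < 0}

theorem isOpen_beyondChamber (f : Fin n → ℕ) : IsOpen (beyondChamber f) := by
  refine IsOpen.union (isOpen_iUnion fun i => ?_) (isOpen_iUnion fun i => isOpen_iUnion fun j =>
    isOpen_iUnion fun _ => isOpen_iUnion fun _ => ?_)
  · exact isOpen_lt (by fun_prop) continuous_const
  · exact isOpen_lt (by fun_prop) continuous_const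

theorem disjoint_chamber_beyondChamber (f : Fin n → ℕ) :
    Disjoint (chamber f) (beyondChamber f) := by
  rw [Set.disjoint_left]
  rintro x ⟨h1, h2⟩ (h | h)
  · obtain ⟨i, hi⟩ := Set.mem_iUnion.1 h
    exact absurd (h1 i) (not_lt.2 (le_of_lt hi))
  · simp only [Set.mem_iUnion] at h
    obtain ⟨i, j, hij, hp, h⟩ := h
    exact absurd (h2 i j hij hp) (not_lt.2 (le_of_lt h))

theorem IsGeneric.mem_chamber_or {x : Fin n → ℝ} (hx : IsGeneric x) (f : Fin n → ℕ) :
    x ∈ chamber f ∪ beyondChamber f := by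
  by_contra h
  rw [Set.mem_union, not_or] at h
  simp only [beyondChamber, Set.mem_union, Set.mem_iUnion, Set.mem_ofPred_eq, not_or, not_exists,
    not_lt] at h
  refine h.1 ⟨fun i => lt_of_le_of_ne (h.2.1 i) ?_, fun i j hij hp =>
    lt_of_le_of_ne (h.2.2 i j hij hp) ?_⟩
  · exact (mul_ne_zero (pow_ne_zero _ (by norm_num)) (hx.1 i)).symm
  · have hne : i ≠ j := fun he => by simp [he] at hij
    exact (mul_ne_zero (pow_ne_zero _ (by norm_num)) (hx.2 i j hne)).symm

/-- The chamber is convex and avoids all hyperplanes, so its slice is connected. The generic points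
are covered by two disjoint open sets, the chamber and what lies beyond its walls, so the component
cannot leave it. -/
theorem connectedComponentIn_eq_chamber {l : Fin n → ℝ} {f : Fin n → ℕ} {x : Fin n → ℝ}
    (hx : x ∈ chamber f) (hxl : x ∈ slice l) :
    connectedComponentIn (slice l \ ⋃ H ∈ arrangement n, H ∩ slice l) x = chamber f ∩ slice l := by
  apply Set.Subset.antisymm
  · have hxU := mem_complement_iff.2 ⟨hxl, isGeneric_of_mem_chamber hx⟩
    refine Set.subset_inter ?_ fun y hy =>
      (mem_complement_iff.1 (connectedComponentIn_subset _ _ hy)).1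
    refine isPreconnected_connectedComponentIn.subset_left_of_subset_union (isOpen_chamber f)
      (isOpen_beyondChamber f) (disjoint_chamber_beyondChamber f) (fun y hy => ?_)
      ⟨x, mem_connectedComponentIn hxU, hx⟩
    exact (mem_complement_iff.1 (connectedComponentIn_subset _ _ hy)).2.mem_chamber_or f
  · refine ((convex_chamber f).inter (convex_slice l)).isPreconnected.subset_connectedComponentIn
      ⟨hx, hxl⟩ fun y hy => ?_
    exact mem_complement_iff.2 ⟨hy.2, isGeneric_of_mem_chamber hy.1⟩

/-! ### Unbounded regions -/

theorem IsGeneric.smul {x : Fin n → ℝ} (hx : IsGeneric x) {a : ℝ} (ha : a ≠ 0) :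
    IsGeneric (a • x) := by
  refine ⟨fun i => mul_ne_zero ha (hx.1 i), fun i j hij => ?_⟩
  simp only [Pi.smul_apply, smul_eq_mul, ← mul_add]
  exact mul_ne_zero ha (hx.2 i j hij)

/-- The ray x + td lowers the linear form, so rescaling its points back to the slice sends them to
infinity; genericity is invariant under nonzero scaling. In terms of c = -l·d, the rescaled curve is
the straight ray with direction d + cx. -/
theorem not_isBounded_of_ray [NeZero n] {l x d : Fin n → ℝ} (hxl : x ∈ slice l)
    (hd : ∑ i, l i * d i < 0) (hgen : ∀ t : ℝ, 0 ≤ t → IsGeneric (x + t • d)) :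
    ¬ Bornology.IsBounded
      (connectedComponentIn (slice l \ ⋃ H ∈ arrangement n, H ∩ slice l) x) := by
  intro hb
  set c := -∑ i, l i * d i with hc
  have hcpos : 0 < c := by linarith
  let v : Fin n → ℝ := d + c • x
  have hv : ∀ t : ℝ, 0 ≤ t → x + t • v ∈ slice l \ ⋃ H ∈ arrangement n, H ∩ slice l := by
    intro t ht
    refine mem_complement_iff.2 ⟨?_, ?_⟩
    · simp only [slice, Set.mem_ofPred_eq] at hxl ⊢
      calc ∑ i, l i * (x + t • v) i
          = ∑ i, l i * x i + t * (∑ i, l i * d i + c * ∑ i, l i * x i) := by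
            rw [Finset.mul_sum, ← Finset.sum_add_distrib, Finset.mul_sum,
              ← Finset.sum_add_distrib]
            refine Finset.sum_congr rfl fun i _ => ?_
            simp only [v, Pi.add_apply, Pi.smul_apply, smul_eq_mul]
            ring
        _ = 1 := by rw [hxl, hc]; ring
    · have hpos : 0 < 1 + t * c := by positivity
      have he : x + t • v = (1 + t * c) • (x + (t / (1 + t * c)) • d) := by
        funext i
        simp only [v, Pi.add_apply, Pi.smul_apply, smul_eq_mul]
        field_simp
        ring
      rw [he]
      exact (hgen _ (by positivity)).smul hpos.ne'
  have hsub : (fun t : ℝ => x + t • v) '' Set.Ici 0 ⊆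
      connectedComponentIn (slice l \ ⋃ H ∈ arrangement n, H ∩ slice l) x := by
    refine IsPreconnected.subset_connectedComponentIn ?_ ⟨0, Set.self_mem_Ici, by simp⟩ ?_
    · exact isPreconnected_Ici.image _ (by fun_prop)
    · rintro _ ⟨t, ht, rfl⟩
      exact hv t ht
  -- The direction v is c times the generic point x + (1/c)d, so its coordinates do not vanish.
  have hv0 : v 0 ≠ 0 := by
    have h := (hgen (1 / c) (by positivity)).1 0
    intro h0
    apply h
    simp only [v, Pi.add_apply, Pi.smul_apply, smul_eq_mul] at h0 ⊢
    field_simp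
    linarith
  obtain ⟨M, hM⟩ := (hb.subset hsub).exists_norm_le
  have hMt : ∀ t : ℝ, 0 ≤ t → |x 0 + t * v 0| ≤ M := fun t ht => by
    have := (norm_le_pi_norm (x + t • v) 0).trans (hM _ ⟨t, ht, rfl⟩)
    simpa using this
  have hM0 : 0 ≤ M := (abs_nonneg _).trans (hMt 0 le_rfl)
  have hvpos : 0 < |v 0| := abs_pos.2 hv0
  have hx0 := hMt 0 le_rfl
  rw [zero_mul, add_zero] at hx0
  -- At this time the displacement of coordinate 0 is 2M + 1, more than two points of absolute value
  -- at most `M` can differ by.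
  have h1 := hMt ((2 * M + 1) / |v 0|) (by positivity)
  have h2 : |(2 * M + 1) / |v 0| * v 0| = 2 * M + 1 := by
    rw [abs_mul, abs_div, abs_abs, abs_of_pos (by positivity : 0 < 2 * M + 1)]
    field_simp
  have h3 := abs_sub_abs_le_abs_sub ((2 * M + 1) / |v 0| * v 0) (-x 0)
  rw [abs_neg, sub_neg_eq_add, add_comm _ (x 0)] at h3
  linarith

/-- If no positive entry exceeds |x i|, then x i can decrease forever without crossing a hyperplane,
so the region is unbounded. -/
theorem exists_pos_of_bounded [NeZero n] {l x : Fin n → ℝ} (hl : StronglyDecreasing l)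
    (hxl : x ∈ slice l) (hx : IsGeneric x) (hb : Bornology.IsBounded
      (connectedComponentIn (slice l \ ⋃ H ∈ arrangement n, H ∩ slice l) x))
    {i : Fin n} (hi : x i < 0) : ∃ j, 0 < x j ∧ |x i| < |x j| := by
  by_contra! hcon
  refine not_isBounded_of_ray hxl (d := Pi.single i (-1)) ?_ (fun t ht => ⟨fun j => ?_, ?_⟩) hb
  · simp only [Pi.single_apply, mul_ite, mul_neg, mul_one, mul_zero, Finset.sum_ite_eq',
      Finset.mem_univ, if_true]
    linarith [(hl i).1]
  · by_cases hj : j = i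
    · subst hj
      simp only [Pi.add_apply, Pi.smul_apply, Pi.single_eq_same, smul_eq_mul]
      exact ne_of_lt (by linarith)
    · simpa [hj] using hx.1 j
  · have key : ∀ j, j ≠ i → x i + x j + t * (-1) < 0 := by
      intro j hj
      rcases lt_or_gt_of_ne (hx.1 j) with h | h
      · linarith
      · have h1 := hcon j h
        rw [abs_of_pos h, abs_of_neg hi] at h1
        have h2 : x i + x j < 0 := lt_of_le_of_ne (by linarith) (hx.2 i j hj.symm)
        linarith
    intro j k hjk
    simp only [Pi.add_apply, Pi.smul_apply, smul_eq_mul]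
    by_cases hj : j = i
    · subst hj
      rw [Pi.single_eq_same, Pi.single_eq_of_ne hjk.symm]
      have := key k hjk.symm
      exact ne_of_lt (by linarith)
    · by_cases hk : k = i
      · subst hk
        rw [Pi.single_eq_same, Pi.single_eq_of_ne hjk]
        have := key j hjk
        exact ne_of_lt (by linarith)
      · rw [Pi.single_eq_of_ne hj, Pi.single_eq_of_ne hk]
        simpa using hx.2 j k hjk

/-- Entries in `S` move away from 0 at equal speed. A constrained sum with both entries in `S` is
unchanged; since `S` is closed under smaller block indices, in the other cases at most the dominant
entry moves, and it grows. -/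
theorem add_smul_mem_chamber {f : Fin n → ℕ} {x : Fin n → ℝ} (hx : x ∈ chamber f)
    {S : Finset (Fin n)} (hS : ∀ j ∈ S, ∀ i, f i < f j → i ∈ S) {t : ℝ} (ht : 0 ≤ t) :
    x + t • (fun i => if i ∈ S then (-1) ^ f i else 0) ∈ chamber f := by
  have hsq : ∀ k : ℕ, (-1 : ℝ) ^ k * (-1) ^ k = 1 := fun k => by
    rw [← mul_pow]
    norm_num
  have hnonneg : ∀ i, 0 ≤ (-1) ^ f i * (t * if i ∈ S then (-1 : ℝ) ^ f i else 0) := by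
    intro i
    split_ifs
    · rw [mul_left_comm, hsq, mul_one]
      exact ht
    · simp
  refine ⟨fun i => ?_, fun i j hij hp => ?_⟩
  · simp only [Pi.add_apply, Pi.smul_apply, smul_eq_mul, mul_add]
    exact add_pos_of_pos_of_nonneg (hx.1 i) (hnonneg i)
  · simp only [Pi.add_apply, Pi.smul_apply, smul_eq_mul]
    rw [add_add_add_comm, mul_add]
    refine add_pos_of_pos_of_nonneg (hx.2 i j hij hp) ?_
    by_cases hj : j ∈ S
    · rw [if_pos hj, if_pos (hS j hj i hij)]
      have : (-1 : ℝ) ^ f j = -(-1) ^ f i := by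
        rcases Nat.even_or_odd (f i) with h | h <;> rcases Nat.even_or_odd (f j) with h' | h'
        · exact absurd (iff_of_true h h') hp
        · rw [h.neg_one_pow, h'.neg_one_pow]
        · rw [h.neg_one_pow, h'.neg_one_pow, neg_neg]
        · exact absurd (iff_of_false (Nat.not_even_iff_odd.2 h) (Nat.not_even_iff_odd.2 h')) hp
      rw [this]
      simp
    · rw [if_neg hj, mul_zero, add_zero]
      exact hnonneg i

theorem sum_sub_le_sum {l : Fin n → ℝ} (hl : StronglyDecreasing l) {S : Finset (Fin n)} {m : Fin n}
    (hm : m ∈ S) (hmin : ∀ j ∈ S, m ≤ j) {e : Fin n → ℝ} (he : ∀ i, |e i| ≤ 1) :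
    |∑ i ∈ S, l i * e i - l m * e m| ≤ ∑ j ∈ Finset.Ioi m, l j := by
  rw [← Finset.add_sum_erase S _ hm, add_sub_cancel_left]
  calc |∑ i ∈ S.erase m, l i * e i| ≤ ∑ i ∈ S.erase m, |l i * e i| :=
        Finset.abs_sum_le_sum_abs _ _
    _ ≤ ∑ i ∈ S.erase m, l i := by
        refine Finset.sum_le_sum fun i _ => ?_
        rw [abs_mul, abs_of_pos (hl i).1]
        exact mul_le_of_le_one_right (hl i).1.le (he i)
    _ ≤ ∑ j ∈ Finset.Ioi m, l j := by
        refine Finset.sum_le_sum_of_subset_of_nonneg (fun i hi => ?_) fun i _ _ => (hl i).1.le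
        obtain ⟨h1, h2⟩ := Finset.mem_erase.1 hi
        exact Finset.mem_Ioi.2 (lt_of_le_of_ne (hmin i h2) h1.symm)

theorem exists_chamber_of_bounded [NeZero n] {l x : Fin n → ℝ} (hl : StronglyDecreasing l)
    (hxl : x ∈ slice l) (hx : IsGeneric x) (hb : Bornology.IsBounded
      (connectedComponentIn (slice l \ ⋃ H ∈ arrangement n, H ∩ slice l) x)) :
    ∃ f ∈ evenMin (Fin n), x ∈ chamber f := by
  have hsign : ∀ i, signVector x i = 1 ↔ 0 < x i := by
    intro i
    unfold signVector
    split_ifs with h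
    · simp [h]
    · simp only [h, iff_false]
      decide
  obtain ⟨f, hf, hc⟩ := exists_compatible (r := fun i => -|x i|) (s := signVector x)
    (fun i j hs h => by
      have hij : i ≠ j := fun he => hs (by rw [he])
      rcases abs_eq_abs.1 (neg_inj.1 h) with h | h
      · exact hs (by simp only [signVector, h])
      · exact hx.2 i j hij (by rw [h]; ring))
    (fun i hi => by
      have hneg : x i < 0 := by
        refine lt_of_le_of_ne (not_lt.1 fun h => ?_) (hx.1 i)
        rw [(hsign i).2 h] at hi
        exact absurd hi (by decide)
      obtain ⟨j, hj, hij⟩ := exists_pos_of_bounded hl hxl hx hb hneg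
      exact ⟨j, (hsign j).2 hj, neg_lt_neg hij⟩)
  have hxf : x ∈ chamber f := mem_chamber_iff.2 ⟨hx.1, hc⟩
  refine ⟨f, ⟨hf, fun m hm => ?_⟩, hxf⟩
  by_contra hodd
  rw [Nat.not_even_iff_odd] at hodd
  -- Since `m` is a left-to-right minimum it is the least index in `S`. Its negative direction thus
  -- outweighs the rest of `S` in the linear form.
  let S : Finset (Fin n) := Finset.univ.filter fun j => f j < f m ∨ j = m
  have hmS : m ∈ S := by simp [S]
  refine not_isBounded_of_ray hxl (d := fun i => if i ∈ S then (-1) ^ f i else 0) ?_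
    (fun t ht => isGeneric_of_mem_chamber (add_smul_mem_chamber hxf ?_ ht)) hb
  · have hmin : ∀ j ∈ S, m ≤ j := by
      intro j hj
      rcases (Finset.mem_filter.1 hj).2 with h | rfl
      · by_contra! hlt
        exact absurd (hm j hlt) (not_lt.2 h.le)
      · exact le_rfl
    have h := sum_sub_le_sum hl hmS hmin (e := fun i => (-1) ^ f i) fun i => by simp
    have h2 := (hl m).2
    simp only [mul_ite, mul_zero, Finset.sum_ite_mem, Finset.univ_inter]
    simp only [hodd.neg_one_pow] at h
    have := (abs_le.1 h).2
    linarith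
  · intro j hj i hij
    refine Finset.mem_filter.2 ⟨Finset.mem_univ _, Or.inl ?_⟩
    rcases (Finset.mem_filter.1 hj).2 with h | rfl
    · exact hij.trans h
    · exact hij

/-! ### Bounded regions -/

/-- A discrete layer-cake argument: the weighted sum integrates the weights of the level sets, each
nonempty one weighing at least δ. The induction peels off the lowest positive layer, of height c,
and removes at least one element from the support. -/
theorem mul_le_sum_of_levelSets {ι : Type*} [Fintype ι] {w : ι → ℝ} {δ : ℝ} (hδ : 0 ≤ δ)
    (y : ι → ℝ) (hy : ∀ i, 0 ≤ y i)
    (h : ∀ t : ℝ, 0 ≤ t → (∃ i, t < y i) → δ ≤ ∑ i with t < y i, w i) (i : ι) :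
    δ * y i ≤ ∑ i, w i * y i := by
  classical
  induction hk : (Finset.univ.filter fun i => 0 < y i).card using Nat.strong_induction_on
    generalizing y i with
  | _ k ih =>
    rcases (Finset.univ.filter fun i => 0 < y i).eq_empty_or_nonempty with he | hne
    · have h0 : ∀ i, y i = 0 := fun i => by
        have : i ∉ Finset.univ.filter fun i => 0 < y i := by simp [he]
        exact le_antisymm (by simpa using this) (hy i)
      simp [h0]
    · obtain ⟨i₀, hi₀, hmin⟩ := Finset.exists_min_image _ y hne
      have hc : 0 < y i₀ := (Finset.mem_filter.1 hi₀).2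
      set c := y i₀ with hcdef
      have hmin' : ∀ i, 0 < y i → c ≤ y i := fun i hi => hmin i (by simpa using hi)
      let y' : ι → ℝ := fun i => if 0 < y i then y i - c else 0
      have hy' : ∀ i, 0 ≤ y' i := by
        intro i
        simp only [y']
        split_ifs with hi
        · linarith [hmin' i hi]
        · exact le_rfl
      have hlevel : ∀ t : ℝ, 0 ≤ t → ∀ i, t < y' i ↔ t + c < y i := by
        intro t ht i
        simp only [y']
        split_ifs with hi
        · exact lt_sub_iff_add_lt
        · constructor
          · intro h'
            linarith
          · intro h'
            linarith
      have hcard : (Finset.univ.filter fun i => 0 < y' i).card < k := by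
        rw [← hk]
        refine Finset.card_lt_card ⟨fun i hi => ?_, fun hsub => ?_⟩
        · have := (hlevel 0 le_rfl i).1 (Finset.mem_filter.1 hi).2
          exact Finset.mem_filter.2 ⟨Finset.mem_univ _, by linarith⟩
        · have := (hlevel 0 le_rfl i₀).1 (Finset.mem_filter.1 (hsub hi₀)).2
          linarith
      have hstep := ih _ hcard y' hy' (fun t ht hex => by
        simp only [hlevel t ht] at hex ⊢
        exact h (t + c) (by linarith) hex) i rfl
      have hsum : ∑ i, w i * y i = ∑ i, w i * y' i + c * ∑ i with 0 < y i, w i := by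
        rw [Finset.sum_filter, Finset.mul_sum, ← Finset.sum_add_distrib]
        refine Finset.sum_congr rfl fun i _ => ?_
        simp only [y']
        split_ifs with hi
        · ring
        · rw [le_antisymm (not_lt.1 hi) (hy i)]
          ring
      have h0 := mul_le_mul_of_nonneg_left (h 0 le_rfl ⟨i₀, hc⟩) hc.le
      rw [hsum]
      have hyi : δ * y i ≤ δ * y' i + c * δ := by
        simp only [y']
        split_ifs with hi
        · linarith
        · rw [le_antisymm (not_lt.1 hi) (hy i)]
          have := mul_nonneg hc.le hδ
          linarith
      linarith

/-- The constant δ is the least gap between a coefficient and the sum of all later ones. A level set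
of |x| is closed under smaller block indices, so its least element has even index and its
coefficient enters with a plus sign. -/
theorem exists_mul_abs_le [NeZero n] {l : Fin n → ℝ} (hl : StronglyDecreasing l) :
    ∃ δ : ℝ, 0 < δ ∧ ∀ f ∈ evenMin (Fin n), ∀ x ∈ chamber f, ∀ i,
      δ * |x i| ≤ ∑ i, l i * x i := by
  obtain ⟨i₀, hi₀⟩ := Finite.exists_min fun i => l i - ∑ j ∈ Finset.Ioi i, l j
  refine ⟨l i₀ - ∑ j ∈ Finset.Ioi i₀, l j, by linarith [(hl i₀).2], fun f hf x hx i => ?_⟩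
  have hc := (mem_chamber_iff.1 hx).2
  have hsum : ∑ i, l i * x i = ∑ i, l i * (-1) ^ f i * |x i| := by
    refine Finset.sum_congr rfl fun i _ => ?_
    have h1 := hx.1 i
    rcases Nat.even_or_odd (f i) with h | h
    · rw [h.neg_one_pow] at h1 ⊢
      rw [abs_of_pos (by linarith), mul_one]
    · rw [h.neg_one_pow] at h1 ⊢
      rw [abs_of_neg (by linarith)]
      ring
  rw [hsum]
  refine mul_le_sum_of_levelSets (by linarith [(hl i₀).2]) (fun i => |x i|)
    (fun i => abs_nonneg _) (fun t ht hex => ?_) i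
  have hne : (Finset.univ.filter fun i => t < |x i|).Nonempty := by
    obtain ⟨i, hi⟩ := hex
    exact ⟨i, by simpa using hi⟩
  have hm := Finset.isLeast_min' _ hne
  set m := Finset.min' _ hne
  have heven : Even (f m) := even_of_isLeast hf (fun j hj i hij => by
    have := hc.lt hf.1 hij
    simp only [Finset.coe_filter, Finset.mem_univ, true_and, Set.mem_ofPred_eq] at hj ⊢
    linarith) hm
  have h := sum_sub_le_sum hl hm.1 (fun j hj => hm.2 hj) (e := fun i => (-1) ^ f i)
    fun i => by simp
  simp only [heven.neg_one_pow, mul_one] at h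
  have h1 := (abs_le.1 h).1
  have h2 := hi₀ m
  linarith

theorem exists_mem_chamber_slice [NeZero n] {l : Fin n → ℝ} (hl : StronglyDecreasing l)
    {f : Fin n → ℕ} (hf : f ∈ evenMin (Fin n)) : ∃ x ∈ chamber f, x ∈ slice l := by
  obtain ⟨δ, hδ, hle⟩ := exists_mul_abs_le hl
  -- Absolute values 1/(k+1) on block k strictly decrease with k, so this point satisfies all the
  -- inequalities; positivity of the linear form allows rescaling to the slice.
  let y : Fin n → ℝ := fun i => (-1) ^ f i * (1 / (f i + 1))
  have hsq : ∀ k : ℕ, (-1 : ℝ) ^ k * (-1) ^ k = 1 := fun k => by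
    rw [← mul_pow]
    norm_num
  have hy : y ∈ chamber f := by
    refine ⟨fun i => ?_, fun i j hij hp => ?_⟩
    · simp only [y, ← mul_assoc, hsq]
      positivity
    · have hsign : (-1 : ℝ) ^ f i * (-1) ^ f j = -1 := by
        rcases Nat.even_or_odd (f i) with h | h <;> rcases Nat.even_or_odd (f j) with h' | h'
        · exact absurd (iff_of_true h h') hp
        · rw [h.neg_one_pow, h'.neg_one_pow, one_mul]
        · rw [h.neg_one_pow, h'.neg_one_pow, mul_one]
        · exact absurd (iff_of_false (Nat.not_even_iff_odd.2 h) (Nat.not_even_iff_odd.2 h')) hp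
      simp only [y, mul_add, ← mul_assoc, hsq, hsign]
      have hlt : (f i : ℝ) + 1 < f j + 1 := by
        have : (f i : ℝ) < f j := by exact_mod_cast hij
        linarith
      have := one_div_lt_one_div_of_lt (by positivity) hlt
      linarith
  have hpos : 0 < ∑ i, l i * y i := by
    refine lt_of_lt_of_le (mul_pos hδ (abs_pos.2 ?_)) (hle f hf y hy 0)
    exact (isGeneric_of_mem_chamber hy).1 0
  refine ⟨(∑ i, l i * y i)⁻¹ • y, ⟨fun i => ?_, fun i j hij hp => ?_⟩, ?_⟩
  · rw [Pi.smul_apply, smul_eq_mul, mul_left_comm]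
    exact mul_pos (inv_pos.2 hpos) (hy.1 i)
  · rw [Pi.smul_apply, Pi.smul_apply, ← smul_add, smul_eq_mul, mul_left_comm]
    exact mul_pos (inv_pos.2 hpos) (hy.2 i j hij hp)
  · simp only [slice, Set.mem_ofPred_eq, Pi.smul_apply, smul_eq_mul]
    simp_rw [mul_left_comm (l _)]
    rw [← Finset.mul_sum, inv_mul_cancel₀ hpos.ne']

theorem isBounded_chamber_slice [NeZero n] {l : Fin n → ℝ} (hl : StronglyDecreasing l)
    {f : Fin n → ℕ} (hf : f ∈ evenMin (Fin n)) : Bornology.IsBounded (chamber f ∩ slice l) := by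
  obtain ⟨δ, hδ, hle⟩ := exists_mul_abs_le hl
  refine (Metric.isBounded_closedBall (x := (0 : Fin n → ℝ)) (r := 1 / δ)).subset ?_
  rintro x ⟨hx, hxl⟩
  rw [mem_closedBall_zero_iff, pi_norm_le_iff_of_nonneg (by positivity)]
  intro i
  have h := hle f hf x hx i
  rw [show ∑ i, l i * x i = 1 from hxl] at h
  rw [Real.norm_eq_abs, le_div_iff₀ hδ]
  linarith

theorem encard_boundedRegions (hn : 1 ≤ n) {l : Fin n → ℝ} (hl : StronglyDecreasing l) :
    (boundedRegions l).encard = pathCount n 0 1 := by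
  have : NeZero n := ⟨by omega⟩
  rw [← encard_evenMin]
  refine encard_eq_of_biunique (fun R f => R = chamber f ∩ slice l) ?_ ?_ ?_ ?_
  · rintro R ⟨⟨x, hx, rfl⟩, hb⟩
    obtain ⟨hxl, hxg⟩ := mem_complement_iff.1 hx
    obtain ⟨f, hf, hxf⟩ := exists_chamber_of_bounded hl hxl hxg hb
    exact ⟨f, hf, connectedComponentIn_eq_chamber hxf hxl⟩
  · intro f hf
    obtain ⟨x, hxf, hxl⟩ := exists_mem_chamber_slice hl hf
    exact ⟨_, ⟨⟨x, mem_complement_iff.2 ⟨hxl, isGeneric_of_mem_chamber hxf⟩,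
      (connectedComponentIn_eq_chamber hxf hxl).symm⟩, isBounded_chamber_slice hl hf⟩, rfl⟩
  · rintro R _ R' _ f _ rfl rfl
    rfl
  · rintro R - f hf f' hf' rfl h
    obtain ⟨x, hxf, hxl⟩ := exists_mem_chamber_slice hl hf
    have hxf' : x ∈ chamber f' := (h.subset ⟨hxf, hxl⟩).1
    exact (mem_chamber_iff.1 hxf).2.unique (mem_chamber_iff.1 hxf').2 hf.1 hf'.1

end Regions

/-! ### From equal finite cardinalities to the bijections -/

theorem nonempty_equiv_of_encard_eq {α β : Type*} {X : Set α} {Y : Set β} {k : ℕ}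
    (hX : X.encard = k) (hY : Y.encard = k) : Nonempty (X ≃ Y) := by
  have hXf : X.Finite := Set.finite_of_encard_eq_coe hX
  have hYf : Y.Finite := Set.finite_of_encard_eq_coe hY
  have : Finite X := hXf
  have : Finite Y := hYf
  refine Finite.card_eq.1 ?_
  rw [Nat.card_coe_set_eq, Nat.card_coe_set_eq, Set.ncard, Set.ncard, hX, hY]

end PlaneTreeDrawings

theorem theorem1 :
    ∃ b : ℕ → ℕ, b 0 = 1 ∧
      (∀ n : ℕ, 1 ≤ n → ∀ l : Fin n → ℝ, PlaneTreeDrawings.StronglyDecreasing l →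
        Nonempty (PlaneTreeDrawings.boundedRegions l ≃ PlaneTreeDrawings.oddMinPartitions n) ∧
        Nonempty (PlaneTreeDrawings.oddMinPartitions n ≃
          PlaneTreeDrawings.positiveMinSignedPerms n) ∧
        Nonempty (PlaneTreeDrawings.positiveMinSignedPerms n ≃
          PlaneTreeDrawings.plusAfterCodes n) ∧
        Nonempty (PlaneTreeDrawings.plusAfterCodes n ≃ PlaneTreeDrawings.plusBeforeCodes n) ∧
        Nonempty (PlaneTreeDrawings.plusBeforeCodes n ≃ PlaneTreeDrawings.klazarTrees n) ∧
        Nonempty (PlaneTreeDrawings.klazarTrees n ≃ PlaneTreeDrawings.drawings n) ∧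
        (PlaneTreeDrawings.boundedRegions l).encard = b n) ∧
      PlaneTreeDrawings.IsPowerSeriesSqrt (PlaneTreeDrawings.egf b)
        (PowerSeries.exp ℚ * (2 - PowerSeries.exp ℚ)⁻¹) := by
  open PlaneTreeDrawings in
  refine ⟨fun n => pathCount n 0 1, rfl, fun n hn l hl => ?_, ?_⟩
  · exact ⟨nonempty_equiv_of_encard_eq (encard_boundedRegions hn hl) (encard_oddMinPartitions n),
      nonempty_equiv_of_encard_eq (encard_oddMinPartitions n) (encard_positiveMinSignedPerms n),
      nonempty_equiv_of_encard_eq (encard_positiveMinSignedPerms n) (encard_plusAfterCodes n),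
      nonempty_equiv_of_encard_eq (encard_plusAfterCodes n) (encard_plusBeforeCodes n),
      nonempty_equiv_of_encard_eq (encard_plusBeforeCodes n) (encard_klazarTrees n),
      nonempty_equiv_of_encard_eq (encard_klazarTrees n) (encard_drawings n),
      encard_boundedRegions hn hl⟩
  · have h : egf (fun n => pathCount n 0 1) = evenMinEgf := by
      simp only [evenMinEgf, card_evenMin]
    rw [h]
    exact isPowerSeriesSqrt_evenMinEgf
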